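/- Let $\mathsf{k}$ be a field of characteristic zero and let $D$ be a Noetherian commutative domain that is a $\mathsf{k}$-algebra. Let $n\ge 0$, let $\sigma=(\sigma_1,\dots,\sigma_n)$ be pairwise commuting $\mathsf{k}$-algebra automorphisms of $D$, and let $a=(a_1,\dots,a_n)$ be non-zero elements of $D$ with $\sigma_i(a_j)=a_j$ for $j\neq i$. The generalized Weyl algebra $D(a,\sigma)$ of rank $n$ is the $\mathsf{k}$-algebra generated over $D$ by $X_i^+,X_i^-$ $(1\le i\le n)$ subject to $$X_i^{+}d=\sigma_i(d)X_i^{+},\quad X_i^{-}d=\sigma_i^{-1}(d)X_i^{-}\ (d\in D),\quad X_i^-X_i^+=a_i,\quad X_i^+X_i^-=\sigma_i(a_i),$$ $$[X_i^-,X_j^+]=[X_i^-,X_j^-]=[X_i^+,X_j^+]=0\quad (i\ne j).$$ For a $\mathsf{k}$-algebra $A$, a subframe is a finite-dimensional subspace of $A$ containing $1$. The Gelfand–Kirillov dimension is $$\mathrm{GK}\,A=\sup_V\limsup_{m\to\infty}\frac{\log\dim V^m}{\log m}\in[0,\infty],$$ with $V$ running over the subframes of $A$. For real $d>0$, a subframe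 $V$ satisfies $VDI(A)_d$ if there is $c>0$ with $\dim VW\ge \dim W+c(\dim W)^{(d-1)/d}$ for all non-zero finite-dimensional subspaces $W\subseteq A$. The lower transcendence degree $\mathrm{LD}\,A\in[0,\infty]$ is the supremum of all $d>0$ such that some subframe of $A$ satisfies $VDI(A)_d$ (and $0$ if there is no such $d$). The algebra $A$ is $\mathrm{LD}$-stable if $\mathrm{LD}\,A=\mathrm{GK}\,A$. **Proposition 5.6.** Suppose that for every finite-dimensional subspace $U\subseteq D$ there is a finite-dimensional subspace $V\subseteq D$ with $U\subseteq V$ and $\sigma_i(V)=V$ for $i=1,\dots,n$. Then $D(a,\sigma)$ is $\mathrm{LD}$-stable, and $$\mathrm{LD}\,D(a,\sigma)=\mathrm{GK}\,D+n .$$ -/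

import Mathlib

open Filter
open scoped ENNReal

noncomputable section

/-! ## Gelfand-Kirillov dimension and lower transcendence degree -/

/-- A subframe of the `k`-algebra `A`: a finite-dimensional subspace containing the unity. -/
def IsSubframe (k : Type*) {A : Type*} [Field k] [Ring A] [Algebra k A]
    (V : Submodule k A) : Prop :=
  FiniteDimensional k V ∧ (1 : A) ∈ V

/-- The Gelfand-Kirillov dimension
`sup_V limsup_m log (dim V ^ m) / log m`, where `V` runs over all subframes of `A`.
It takes values in `[0, ∞]`. -/
def gkDim (k A : Type*) [Field k] [Ring A] [Algebra k A] : ℝ≥0∞ :=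
  ⨆ (V : Submodule k A) (_ : IsSubframe k V),
    limsup (fun m : ℕ =>
      ENNReal.ofReal (Real.log (Module.finrank k ↥(V ^ m)) / Real.log m)) atTop

/-- The volume difference inequality with exponent `d`: there is `c > 0` such that
`dim (V W) ≥ dim W + c (dim W) ^ ((d - 1) / d)` for all finite-dimensional nonzero
subspaces `W` of `A`. -/
def SatisfiesVDI (k : Type*) {A : Type*} [Field k] [Ring A] [Algebra k A]
    (V : Submodule k A) (d : ℝ) : Prop :=
  ∃ c : ℝ, 0 < c ∧ ∀ W : Submodule k A, FiniteDimensional k W → W ≠ ⊥ →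
    (Module.finrank k W : ℝ) + c * (Module.finrank k W : ℝ) ^ ((d - 1) / d) ≤
      (Module.finrank k ↥(V * W) : ℝ)

/-- The lower transcendence degree, with values in `[0, ∞]`: the supremum of the real numbers
`d > 0` such that some subframe satisfies the volume difference inequality with exponent `d`.
If every subframe `V` admits a nonzero finite-dimensional `W` with `dim (V W) = dim W`, then no
such `d` exists and the supremum of the empty set in `[0, ∞]` is `0`, as it should be. -/
def lowerTrDeg (k A : Type*) [Field k] [Ring A] [Algebra k A] : ℝ≥0∞ :=
  ⨆ (V : Submodule k A) (_ : IsSubframe k V) (d : ℝ) (_ : 0 < d) (_ : SatisfiesVDI k V d),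
    ENNReal.ofReal d

/-- An algebra is `LD`-stable if its lower transcendence degree and its Gelfand-Kirillov
dimension coincide. -/
def IsLDStable (k A : Type*) [Field k] [Ring A] [Algebra k A] : Prop :=
  lowerTrDeg k A = gkDim k A

/-! ## Generalized Weyl algebras -/

/-- The data defining a generalized Weyl algebra of rank `n` over the `k`-algebra `D`:
commuting automorphisms `σ i` and central non-zero-divisors `a i` with
`σ i (a j) = a j` for `j ≠ i`. -/
structure GWAData (k D : Type*) [Field k] [Ring D] [Algebra k D] (n : ℕ) where
  σ : Fin n → D ≃ₐ[k] D
  a : Fin n → D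
  σ_comm : ∀ i j d, σ i (σ j d) = σ j (σ i d)
  a_mem_center : ∀ i, a i ∈ Subring.center D
  a_mem_nonZeroDivisors : ∀ i, a i ∈ nonZeroDivisors D
  σ_a : ∀ i j, j ≠ i → σ i (a j) = a j

/-- Generators of a generalized Weyl algebra of rank `n` over `D`: the elements of `D`
and `X i ^ +`, `X i ^ -`. -/
inductive GWAGen (D : Type*) (n : ℕ) where
  | coeff (d : D) : GWAGen D n
  | xp (i : Fin n) : GWAGen D n
  | xm (i : Fin n) : GWAGen D n

namespace GWAData

variable {k D : Type*} [Field k] [Ring D] [Algebra k D] {n : ℕ}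

/-- The generator in the free algebra given by an element of `D`. -/
def co (k : Type*) {D : Type*} [Field k] {n : ℕ} (d : D) : FreeAlgebra k (GWAGen D n) :=
  FreeAlgebra.ι k (GWAGen.coeff d)

/-- The generator `X i ^ +` in the free algebra. -/
def xp (k D : Type*) [Field k] {n : ℕ} (i : Fin n) : FreeAlgebra k (GWAGen D n) :=
  FreeAlgebra.ι k (GWAGen.xp i)

/-- The generator `X i ^ -` in the free algebra. -/
def xm (k D : Type*) [Field k] {n : ℕ} (i : Fin n) : FreeAlgebra k (GWAGen D n) :=
  FreeAlgebra.ι k (GWAGen.xm i)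

/-- Defining relations: the first three say that the elements of `D` multiply, add and are scaled
as in the `k`-algebra `D`; the others are those of the generalized Weyl algebra. -/
inductive Rel (w : GWAData k D n) :
    FreeAlgebra k (GWAGen D n) → FreeAlgebra k (GWAGen D n) → Prop
  | co_add (d e : D) : Rel w (co k (d + e)) (co k d + co k e)
  | co_mul (d e : D) : Rel w (co k (d * e)) (co k d * co k e)
  | co_algebraMap (r : k) :
      Rel w (co k (algebraMap k D r)) (algebraMap k (FreeAlgebra k (GWAGen D n)) r)
  | xp_co (i : Fin n) (d : D) : Rel w (xp k D i * co k d) (co k (w.σ i d) * xp k D i)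
  | xm_co (i : Fin n) (d : D) : Rel w (xm k D i * co k d) (co k ((w.σ i).symm d) * xm k D i)
  | xm_xp (i : Fin n) : Rel w (xm k D i * xp k D i) (co k (w.a i))
  | xp_xm (i : Fin n) : Rel w (xp k D i * xm k D i) (co k (w.σ i (w.a i)))
  | xm_xp_comm (i j : Fin n) : i ≠ j → Rel w (xm k D i * xp k D j) (xp k D j * xm k D i)
  | xm_xm_comm (i j : Fin n) : i ≠ j → Rel w (xm k D i * xm k D j) (xm k D j * xm k D i)
  | xp_xp_comm (i j : Fin n) : i ≠ j → Rel w (xp k D i * xp k D j) (xp k D j * xp k D i)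

end GWAData

/-- The generalized Weyl algebra `D(a, σ)`: the `k`-algebra generated over `D` by `X i ^ +` and
`X i ^ -` subject to the defining relations. -/
abbrev GWA {k D : Type*} [Field k] [Ring D] [Algebra k D] {n : ℕ} (w : GWAData k D n) : Type _ :=
  RingQuot (GWAData.Rel w)

end

/-!
# Lower transcendence degree of generalized Weyl algebras

Write `A = D(a, σ)`. The proof establishes the cycle
`GK D + n ≤ LD A ≤ GK A ≤ GK D + n`, whose members are therefore equal.

*The lattice module.* The algebra `A` acts on the free `D`-module `⨁_α D X^α`, `α ∈ ℤⁿ`, and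
`r ↦ r · X^0` is an injective (in fact bijective) `A`-linear map (`GWAData.toLattice_injective`).
Dimensions of products `V W` in `A` can thus be computed in the lattice module, on which `X_i⁺` acts
by the shift `α ↦ α + ε_i` twisted by injective maps `D → D`.

*`LD A ≤ GK A`* holds for every nonzero algebra (`lowerTrDeg_le_gkDim`): applied to the powers of
`V`, the volume difference inequality with exponent `d` forces `dim V ^ m ≥ δ m ^ d`.

*`GK A ≤ GK D + n`* (`GWAData.gkDim_le`): for a large enough `σ`-stable `V ⊆ D` the elements of a
subframe `U` of `A` raise the degree in the filtration of the lattice module by the subspaces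
`⨁_{|α i| ≤ m} V ^ m X^α` by at most some `s`. Hence
`dim U ^ m ≤ (2 s m + 1) ^ n dim (V ^ s) ^ m`.

*`GK D + n ≤ LD A`* (`GWAData.gkDim_add_le_lowerTrDeg`). By Noether normalization it suffices to show
`t + n ≤ LD A` whenever `D` contains a polynomial ring in `t` variables. The volume difference
inequality is an isoperimetric inequality and is proved one dimension at a time (`Expands.succ`).
Let `W` be a subspace of `⨁_{i ∈ ℤ} N`, let `W_i ⊆ N` be its space of leading coefficients in
degree `i`, and let `x = dim W = ∑ dim W_i`. Adjoining the image of `W` under an injective shift adds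
at least `dim W_i` to the dimension, for each `i`; and if all `dim W_i` are at most `p`, the
inequality with exponent `d` on `N` adds at least `c ∑ (dim W_i)^(1 - 1/d) ≥ c p^(-1/d) x`. With
`p = x^(d/(d+1))` either alternative yields the inequality with exponent `d + 1`. Iterating over the
coordinates gives `Expands.finsupp`, which is used twice: for the multiplications by the variables
on a free module over the polynomial ring, in which every finite-dimensional subspace of `D` embeds
after clearing denominators (`expands_mulLeft`), and then for the operators `X_i⁺` on the lattice
module.
-/

noncomputable section

open Module

/-! ### Expansion of finite-dimensional subspaces under a set of operators -/

/-- Enlarging a nonzero finite-dimensional subspace `W` by its images under the operators in `T`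
increases the dimension by at least `c (dim W) ^ ((d - 1) / d)`, with `c > 0` independent of `W`.
The enlargement is expressed through an arbitrary finite-dimensional `W'` containing it. For `d = 0`
the condition is void: the exponent `-∞` of the inequality would be a junk value there. -/
def Expands (k : Type*) {M : Type*} [Field k] [AddCommGroup M] [Module k M]
    (T : Set (End k M)) (d : ℕ) : Prop :=
  d = 0 ∨ ∃ c : ℝ, 0 < c ∧ ∀ W W' : Submodule k M, FiniteDimensional k W' → W ≠ ⊥ → W ≤ W' →
    (∀ f ∈ T, W.map f ≤ W') →
    (finrank k W : ℝ) + c * (finrank k W : ℝ) ^ (((d : ℝ) - 1) / d) ≤ (finrank k W' : ℝ)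

section Expansion

variable {k M N M' : Type*} [Field k] [AddCommGroup M] [Module k M] [AddCommGroup N] [Module k N]
  [AddCommGroup M'] [Module k M']

/-- Expansion is inherited by `M` if its finite-dimensional subspaces embed into `M'` compatibly with
the operators, where the embedding may depend on the subspace. -/
theorem Expands.of_local {S : Set (End k M)} {T : Set (End k M')} {d : ℕ} (h : Expands k T d)
    (hloc : ∀ W : Submodule k M, FiniteDimensional k W → ∃ φ : W →ₗ[k] M', Function.Injective φ ∧
      ∀ f ∈ T, ∃ g ∈ S, ∀ m m' : W, (m' : M) = g m → φ m' = f (φ m)) :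
    Expands k S d := by
  rcases h with h | ⟨c, hc, h⟩
  · exact Or.inl h
  refine Or.inr ⟨c, hc, fun W W' hW' hW hWW' hS => ?_⟩
  obtain ⟨φ, hφ, hT⟩ := hloc W' hW'
  have h1 : finrank k ((W.comap W'.subtype).map φ) = finrank k W := by
    rw [← (Submodule.equivMapOfInjective φ hφ _).finrank_eq]
    exact (Submodule.comapSubtypeEquivOfLe hWW').finrank_eq
  have h2 : finrank k (LinearMap.range φ) = finrank k W' := LinearMap.finrank_range_of_inj hφ
  have h3 := h ((W.comap W'.subtype).map φ) (LinearMap.range φ) inferInstance ?_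
    LinearMap.map_le_range ?_
  · rwa [h1, h2] at h3
  · intro h0
    rw [h0] at h1
    have := Submodule.finiteDimensional_of_le hWW'
    exact hW (Submodule.finrank_eq_zero.1 (by rw [← h1]; simp))
  · intro f hf
    obtain ⟨g, hg, hgf⟩ := hT f hf
    rintro _ ⟨_, ⟨m, hm, rfl⟩, rfl⟩
    have hm' : g m ∈ W' := hS g hg ⟨m, hm, rfl⟩
    exact ⟨⟨g m, hm'⟩, hgf m ⟨g m, hm'⟩ rfl⟩

theorem Expands.of_injective {S : Set (End k M)} {T : Set (End k M')} {d : ℕ} (h : Expands k T d)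
    (φ : M →ₗ[k] M') (hφ : Function.Injective φ)
    (hT : ∀ f ∈ T, ∃ g ∈ S, ∀ m, φ (g m) = f (φ m)) :
    Expands k S d := by
  refine h.of_local fun W _ => ⟨φ ∘ₗ W.subtype, hφ.comp W.injective_subtype, fun f hf => ?_⟩
  obtain ⟨g, hg, hgf⟩ := hT f hf
  exact ⟨g, hg, fun m m' h => by simp [h, hgf]⟩

theorem finrank_map_add_finrank_inf_ker (f : M →ₗ[k] N) (W : Submodule k M)
    [FiniteDimensional k W] :
    finrank k (W.map f) + finrank k ↥(W ⊓ LinearMap.ker f) = finrank k W := by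
  rw [← LinearMap.finrank_range_add_finrank_ker (f.domRestrict W), LinearMap.range_domRestrict,
    LinearMap.ker_domRestrict, ← Submodule.map_comap_subtype,
    ← (Submodule.equivMapOfInjective W.subtype W.injective_subtype _).finrank_eq]

/-- The elements whose components of degree exceeding `i` vanish. -/
def degreeLE (π : ℤ → M →ₗ[k] N) (i : ℤ) : Submodule k M :=
  ⨅ j : Set.Ioi i, LinearMap.ker (π j)

theorem mem_degreeLE {π : ℤ → M →ₗ[k] N} {i : ℤ} {m : M} :
    m ∈ degreeLE π i ↔ ∀ j, i < j → π j m = 0 := by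
  simp [degreeLE]

theorem degreeLE_inf_ker (π : ℤ → M →ₗ[k] N) (i : ℤ) :
    degreeLE π i ⊓ LinearMap.ker (π i) = degreeLE π (i - 1) := by
  ext m
  simp only [Submodule.mem_inf, mem_degreeLE, LinearMap.mem_ker]
  constructor
  · rintro ⟨h1, h2⟩ j hj
    rcases (show i ≤ j by omega).eq_or_lt with rfl | h
    · exact h2
    · exact h1 j h
  · exact fun h => ⟨fun j hj => h j (by omega), h i (by omega)⟩

/-- The space of coefficients in degree `i` of the elements of `W` of degree at most `i`. -/
def leadingCoeffs (π : ℤ → M →ₗ[k] N) (W : Submodule k M) (i : ℤ) : Submodule k N :=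
  (W ⊓ degreeLE π i).map (π i)

theorem finrank_inf_degreeLE (π : ℤ → M →ₗ[k] N) (W : Submodule k M) [FiniteDimensional k W]
    (i : ℤ) : finrank k ↥(W ⊓ degreeLE π i) =
      finrank k (leadingCoeffs π W i) + finrank k ↥(W ⊓ degreeLE π (i - 1)) := by
  rw [← finrank_map_add_finrank_inf_ker (π i) (W ⊓ degreeLE π i), inf_assoc, degreeLE_inf_ker]
  rfl

theorem exists_degree_bounds {π : ℤ → M →ₗ[k] N} (hinj : ∀ m, (∀ i, π i m = 0) → m = 0)
    (hfin : ∀ m, {i | π i m ≠ 0}.Finite) (W : Submodule k M) [hW : FiniteDimensional k W] :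
    ∃ lo hi : ℤ, lo ≤ hi ∧ W ≤ degreeLE π hi ∧ W ⊓ degreeLE π lo = ⊥ := by
  obtain ⟨s, rfl⟩ := (Submodule.fg_iff_finiteDimensional W).2 hW
  have hf : (⋃ m ∈ s, {i | π i m ≠ 0}).Finite := s.finite_toSet.biUnion fun m _ => hfin m
  obtain ⟨B, hB⟩ := hf.bddAbove
  obtain ⟨B', hB'⟩ := hf.bddBelow
  have hup : Submodule.span k (s : Set M) ≤ degreeLE π B := by
    refine Submodule.span_le.2 fun m hm => mem_degreeLE.2 fun j hj => ?_
    by_contra h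
    exact hj.not_ge (hB (Set.mem_biUnion hm h))
  have hlow : ∀ j < B', Submodule.span k (s : Set M) ≤ LinearMap.ker (π j) := by
    refine fun j hj => Submodule.span_le.2 fun m hm => ?_
    by_contra h
    exact hj.not_ge (hB' (Set.mem_biUnion hm h))
  refine ⟨min (B' - 1) B, B, min_le_right _ _, hup, ?_⟩
  rw [eq_bot_iff]
  rintro m ⟨hm, hm'⟩
  refine hinj m fun i => ?_
  by_cases h : i < B'
  · exact hlow i h hm
  · exact mem_degreeLE.1 hm' i (by omega)

/-- A shift operator moves the part of `W` of degree at least `i` into degrees exceeding `i`, where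
it is disjoint from the part of `W` in degrees at most `i`; degree `i` gets counted twice. -/
theorem finrank_add_leadingCoeffs_le {π : ℤ → M →ₗ[k] N} {X : End k M} {ξ : ℤ → End k N}
    (hξ : ∀ i, Function.Injective (ξ i)) (hX : ∀ i m, π (i + 1) (X m) = ξ i (π i m))
    {W W' : Submodule k M} [FiniteDimensional k W'] (hWW' : W ≤ W') (hXW : W.map X ≤ W') (i : ℤ) :
    finrank k W + finrank k (leadingCoeffs π W i) ≤ finrank k W' := by
  have := Submodule.finiteDimensional_of_le hWW'
  have h1 := finrank_map_add_finrank_inf_ker (degreeLE π i).mkQ W'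
  have h2 := finrank_map_add_finrank_inf_ker ((degreeLE π i).mkQ ∘ₗ X) W
  have h3 : LinearMap.ker ((degreeLE π i).mkQ ∘ₗ X) = degreeLE π (i - 1) := by
    ext m
    simp only [LinearMap.mem_ker, LinearMap.comp_apply, Submodule.mkQ_apply,
      Submodule.Quotient.mk_eq_zero, mem_degreeLE]
    constructor
    · intro h j hj
      have := h (j + 1) (by omega)
      rw [hX] at this
      exact hξ j (by rw [this, map_zero])
    · intro h j hj
      obtain ⟨j, rfl⟩ : ∃ j', j = j' + 1 := ⟨j - 1, by ring⟩
      rw [hX, h j (by omega), map_zero]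
  rw [Submodule.ker_mkQ] at h1
  rw [h3] at h2
  have h4 : finrank k (W.map ((degreeLE π i).mkQ ∘ₗ X)) ≤ finrank k (W'.map (degreeLE π i).mkQ) := by
    rw [Submodule.map_comp]
    exact Submodule.finrank_mono (Submodule.map_mono hXW)
  have h5 : finrank k ↥(W ⊓ degreeLE π i) ≤ finrank k ↥(W' ⊓ degreeLE π i) :=
    Submodule.finrank_mono (inf_le_inf_right _ hWW')
  have h6 := finrank_inf_degreeLE π W i
  omega

/-- Since `dim W` is the sum of the dimensions of the spaces of leading coefficients, a comparison of
the latter implies one of the former. -/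
theorem mul_finrank_le_of_leadingCoeffs {π : ℤ → M →ₗ[k] N}
    (hinj : ∀ m, (∀ i, π i m = 0) → m = 0)
    (hfin : ∀ m, {i | π i m ≠ 0}.Finite) {W W' : Submodule k M} [FiniteDimensional k W']
    (hWW' : W ≤ W') (r : ℝ)
    (hr : ∀ i, r * finrank k (leadingCoeffs π W i) ≤ finrank k (leadingCoeffs π W' i)) :
    r * finrank k W ≤ finrank k W' := by
  have := Submodule.finiteDimensional_of_le hWW'
  obtain ⟨lo, hi, hle, hhi, hlo⟩ := exists_degree_bounds hinj hfin W'
  have key : ∀ i, lo ≤ i →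
      r * finrank k ↥(W ⊓ degreeLE π i) ≤ finrank k ↥(W' ⊓ degreeLE π i) := by
    intro i hi
    induction i, hi using Int.leInduction with
    | base =>
      have : W ⊓ degreeLE π lo = ⊥ := eq_bot_iff.2 ((inf_le_inf_right _ hWW').trans hlo.le)
      rw [this, finrank_bot]
      simp
    | succ i hi ih =>
      have h1 := finrank_inf_degreeLE π W (i + 1)
      have h2 := finrank_inf_degreeLE π W' (i + 1)
      rw [add_sub_cancel_right] at h1 h2
      rw [h1, h2]
      push_cast
      linarith [hr (i + 1)]
  have h := key hi hle
  rwa [inf_eq_left.2 hhi, inf_eq_left.2 (hWW'.trans hhi)] at h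

/-- The induction step of the isoperimetric inequality: a shift operator raises the exponent by one.
The maps `π i` are the components of a `ℤ`-grading of `M` by copies of `N`. -/
theorem Expands.succ {π : ℤ → M →ₗ[k] N} (hinj : ∀ m, (∀ i, π i m = 0) → m = 0)
    (hfin : ∀ m, {i | π i m ≠ 0}.Finite) {S : Set (End k N)} {T : Set (End k M)}
    (hST : ∀ f ∈ S, ∃ g ∈ T, ∀ i m, π i (g m) = f (π i m))
    {X : End k M} (hXT : X ∈ T) {ξ : ℤ → End k N}
    (hξ : ∀ i, Function.Injective (ξ i)) (hX : ∀ i m, π (i + 1) (X m) = ξ i (π i m))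
    {d : ℕ} (hS : Expands k S d) : Expands k T (d + 1) := by
  have hpos : ∀ {W : Submodule k M} [FiniteDimensional k W], W ≠ ⊥ → (1 : ℝ) ≤ finrank k W := by
    intro W _ hW
    exact_mod_cast Nat.one_le_iff_ne_zero.2 fun h => hW (Submodule.finrank_eq_zero.1 h)
  rcases Nat.eq_zero_or_pos d with rfl | hd
  · refine Or.inr ⟨1, one_pos, fun W W' _ hW hWW' hT => ?_⟩
    have := Submodule.finiteDimensional_of_le hWW'
    have hex : ∃ i, finrank k (leadingCoeffs π W i) ≠ 0 := by
      by_contra! h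
      have h1 := mul_finrank_le_of_leadingCoeffs hinj hfin (le_refl W) 2 (fun i => by simp [h])
      linarith [hpos hW]
    obtain ⟨i, hi⟩ := hex
    have h1 := finrank_add_leadingCoeffs_le hξ hX hWW' (hT X hXT) i
    simp only [zero_add, Nat.cast_one, sub_self, zero_div, Real.rpow_zero, mul_one]
    exact_mod_cast (show finrank k W + 1 ≤ finrank k W' by omega)
  obtain ⟨c, hc, hS⟩ := hS.resolve_left hd.ne'
  refine Or.inr ⟨min 1 c, lt_min one_pos hc, fun W W' _ hW hWW' hT => ?_⟩
  have := Submodule.finiteDimensional_of_le hWW'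
  have hd0 : (0 : ℝ) < d := by exact_mod_cast hd
  set x : ℝ := ((finrank k W : ℕ) : ℝ) with hx
  have hN : (1 : ℝ) ≤ x := hpos hW
  have hx0 : 0 < x := by linarith
  have hexp : (((d + 1 : ℕ) : ℝ) - 1) / ((d + 1 : ℕ) : ℝ) = d / (d + 1) := by push_cast; ring_nf
  rw [hexp]
  set p : ℝ := x ^ ((d : ℝ) / (d + 1)) with hp
  have hp0 : 0 < p := Real.rpow_pos_of_pos hx0 _
  -- The threshold for `dim W_i` at which the two lower bounds balance.
  by_cases hbig : ∃ i, p ≤ finrank k (leadingCoeffs π W i)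
  · obtain ⟨i, hi⟩ := hbig
    have h1 := finrank_add_leadingCoeffs_le hξ hX hWW' (hT X hXT) i
    have h2 : x + (finrank k (leadingCoeffs π W i) : ℝ) ≤ finrank k W' := by
      rw [hx]
      exact_mod_cast h1
    have : min 1 c * p ≤ 1 * p := mul_le_mul_of_nonneg_right (min_le_left _ _) hp0.le
    linarith
  · push Not at hbig
    have h1 := mul_finrank_le_of_leadingCoeffs hinj hfin hWW' (1 + c * p ^ (-(1 / d) : ℝ)) ?_
    · have h2 : p ^ (-(1 / d) : ℝ) * x = p := by
        rw [hp, ← Real.rpow_mul hx0.le]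
        nth_rw 2 [← Real.rpow_one x]
        rw [← Real.rpow_add hx0]
        congr 1
        field_simp
        ring
      have h3 : min 1 c * p ≤ c * p := mul_le_mul_of_nonneg_right (min_le_right _ _) hp0.le
      have h4 : (1 + c * p ^ (-(1 / d) : ℝ)) * x = x + c * p := by
        rw [add_mul, one_mul, mul_assoc, h2]
      linarith
    · intro i
      by_cases h0 : leadingCoeffs π W i = ⊥
      · rw [h0]; simp
      have hmono : ∀ i, leadingCoeffs π W i ≤ leadingCoeffs π W' i := fun i =>
        Submodule.map_mono (inf_le_inf_right _ hWW')
      have h1 := hS (leadingCoeffs π W i) (leadingCoeffs π W' i) (by unfold leadingCoeffs; infer_instance) h0 (hmono i) ?_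
      · set y : ℝ := ((finrank k (leadingCoeffs π W i) : ℕ) : ℝ) with hy
        have hy1 : (1 : ℝ) ≤ y := by
          rw [hy]
          have : FiniteDimensional k (leadingCoeffs π W i) := by
            unfold leadingCoeffs; infer_instance
          exact_mod_cast Nat.one_le_iff_ne_zero.2 fun h => h0 (Submodule.finrank_eq_zero.1 h)
        have hy0 : 0 < y := by linarith
        have h2 : y ^ (((d : ℝ) - 1) / d) = y ^ (-(1 / d) : ℝ) * y := by
          nth_rw 3 [← Real.rpow_one y]
          rw [← Real.rpow_add hy0]
          congr 1
          field_simp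
          ring
        have h3 : p ^ (-(1 / d) : ℝ) ≤ y ^ (-(1 / d) : ℝ) :=
          Real.rpow_le_rpow_of_nonpos hy0 (hbig i).le (by rw [neg_nonpos]; positivity)
        have h4 : c * (p ^ (-(1 / d) : ℝ) * y) ≤ c * (y ^ (-(1 / d) : ℝ) * y) := by gcongr
        rw [h2] at h1
        calc _ = y + c * (p ^ (-(1 / d) : ℝ) * y) := by ring
          _ ≤ _ := by linarith
      · intro f hf
        obtain ⟨g, hg, hgf⟩ := hST f hf
        rintro _ ⟨_, ⟨m, ⟨hm, hm'⟩, rfl⟩, rfl⟩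
        refine ⟨g m, ⟨hT g hg ⟨m, hm, rfl⟩, mem_degreeLE.2 fun j hj => ?_⟩, hgf i m⟩
        rw [hgf, mem_degreeLE.1 hm' j hj, map_zero]

end Expansion

/-! ### Shift operators on finitely supported functions on the lattice `ℤⁿ` -/

section Shift

variable {k D : Type*} [Field k] [AddCommGroup D] [Module k D] {n : ℕ}

/-- The operator on `⨁_α D x^α`, `α ∈ ℤⁿ`, sending `e x^α` to `ξ_p(e) x^(α + δ ε_j)`, where
`p = α j` and `ε_j` is the `j`-th unit vector. -/
def shiftOp (ξ : ℤ → End k D) (j : Fin n) (δ : ℤ) : End k ((Fin n → ℤ) →₀ D) :=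
  Finsupp.lsum k fun α => Finsupp.lsingle (α + Pi.single j δ) ∘ₗ ξ (α j)

@[simp]
theorem shiftOp_single (ξ : ℤ → End k D) (j : Fin n) (δ : ℤ) (α : Fin n → ℤ) (e : D) :
    shiftOp ξ j δ (Finsupp.single α e) = Finsupp.single (α + Pi.single j δ) (ξ (α j) e) := by
  simp [shiftOp]

theorem shiftOp_apply (ξ : ℤ → End k D) (j : Fin n) (δ : ℤ) (m : (Fin n → ℤ) →₀ D)
    (α : Fin n → ℤ) : shiftOp ξ j δ m α = ξ (α j - δ) (m (α - Pi.single j δ)) := by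
  induction m using Finsupp.induction_linear with
  | zero => simp
  | add f g hf hg => simp [hf, hg]
  | single β e =>
    classical
    rw [shiftOp_single, Finsupp.single_apply, Finsupp.single_apply]
    by_cases h : β = α - Pi.single j δ
    · subst h
      simp
    · rw [if_neg h, if_neg (fun h' => h (eq_sub_of_add_eq h')), map_zero]

/-- The part of degree `i` in the first coordinate. -/
def firstCoord (k D : Type*) [Field k] [AddCommGroup D] [Module k D] (n : ℕ) (i : ℤ) :
    ((Fin (n + 1) → ℤ) →₀ D) →ₗ[k] ((Fin n → ℤ) →₀ D) :=
  Finsupp.lcomapDomain (fun β : Fin n → ℤ => (Fin.cons i β : Fin (n + 1) → ℤ))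
    (Fin.cons_right_injective (α := fun _ => ℤ) i)

@[simp]
theorem firstCoord_apply (i : ℤ) (m : (Fin (n + 1) → ℤ) →₀ D) (β : Fin n → ℤ) :
    firstCoord k D n i m β = m (Fin.cons i β) := rfl

/-- Adjoining `n` independent twisted shifts raises the exponent by `n`. -/
theorem Expands.finsupp {S : Set (End k D)} {d : ℕ} (hS : Expands k S d)
    (ξ : Fin n → ℤ → End k D) (hξ : ∀ j p, Function.Injective (ξ j p)) :
    Expands k (Finsupp.mapRange.linearMap '' S ∪ Set.range fun j => shiftOp (ξ j) j 1)
      (d + n) := by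
  induction n with
  | zero =>
    refine hS.of_injective (Finsupp.lapply 0) ?_ ?_
    · intro m m' h
      refine Finsupp.ext fun α => ?_
      rw [Subsingleton.elim α 0]
      exact h
    · exact fun f hf => ⟨_, Or.inl ⟨f, hf, rfl⟩, fun m => by simp⟩
  | succ n ih =>
    refine (ih (fun j => ξ j.succ) fun j => hξ j.succ).succ (π := firstCoord k D n)
      (X := shiftOp (ξ 0) 0 1) (ξ := fun p => Finsupp.mapRange.linearMap (ξ 0 p)) ?_ ?_ ?_
      (Or.inr ⟨0, rfl⟩) ?_ ?_
    · intro m hm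
      ext α
      have := DFunLike.congr_fun (hm (α 0)) (Fin.tail α)
      simpa using this
    · refine fun m => (m.support.finite_toSet.image fun α => α 0).subset fun i hi => ?_
      obtain ⟨β, hβ⟩ := Finsupp.ne_iff.1 hi
      exact ⟨Fin.cons i β, by simpa using hβ, by simp⟩
    · rintro f (⟨f, hf, rfl⟩ | ⟨j, rfl⟩)
      · exact ⟨_, Or.inl ⟨f, hf, rfl⟩, fun i m => by ext β; simp⟩
      · refine ⟨_, Or.inr ⟨j.succ, rfl⟩, fun i m => ?_⟩
        ext β
        simp only [firstCoord_apply, shiftOp_apply, Fin.cons_succ]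
        congr 2
        ext l
        refine Fin.cases ?_ (fun l => ?_) l <;> simp [Pi.single_apply]
    · exact fun p => Finsupp.mapRange_injective _ (map_zero _) (hξ 0 p)
    · intro i m
      ext β
      simp only [firstCoord_apply, shiftOp_apply, Fin.cons_zero, add_sub_cancel_right,
        Finsupp.mapRange.linearMap_apply, Finsupp.mapRange_apply]
      congr 2
      ext l
      refine Fin.cases ?_ (fun l => ?_) l <;> simp

end Shift

/-! ### Expansion in commutative domains -/

section Commutative

variable {k D : Type*} [Field k] [CommRing D] [IsDomain D] [Algebra k D]

/-- Finitely supported families of polynomials, as finitely supported functions on the lattice. -/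
def latticeCoeffs (k ι : Type*) [Field k] (t : ℕ) :
    (ι →₀ MvPolynomial (Fin t) k) →ₗ[k] ((Fin t → ℤ) →₀ (ι →₀ k)) :=
  Finsupp.lmapDomain (ι →₀ k) k (fun (e : Fin t →₀ ℕ) (i : Fin t) => (e i : ℤ)) ∘ₗ
    (Finsupp.mapRange.linearEquiv (MvPolynomial.basisMonomials (Fin t) k).repr ≪≫ₗ
      (Finsupp.curryLinearEquiv k).symm ≪≫ₗ
      Finsupp.domLCongr (Equiv.prodComm ι (Fin t →₀ ℕ)) ≪≫ₗ
      Finsupp.curryLinearEquiv k).toLinearMap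

theorem latticeCoeffs_injective (k ι : Type*) [Field k] (t : ℕ) :
    Function.Injective (latticeCoeffs k ι t) := by
  have h : Function.Injective (fun (e : Fin t →₀ ℕ) (i : Fin t) => (e i : ℤ)) := fun e e' h => by
    ext i
    exact Int.ofNat_injective (congrFun h i)
  rw [latticeCoeffs, LinearMap.coe_comp]
  exact (Finsupp.mapDomain_injective h).comp (LinearEquiv.injective _)

theorem latticeCoeffs_single_monomial {ι : Type*} {t : ℕ} (i : ι) (e : Fin t →₀ ℕ) (r : k) :
    latticeCoeffs k ι t (Finsupp.single i (MvPolynomial.monomial e r)) =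
      Finsupp.single (fun j => (e j : ℤ)) (Finsupp.single i r) := by
  have h : (MvPolynomial.basisMonomials (Fin t) k).repr (MvPolynomial.monomial e r) =
      Finsupp.single e r := by
    have h1 : MvPolynomial.monomial e r = r • MvPolynomial.basisMonomials (Fin t) k e := by
      rw [MvPolynomial.coe_basisMonomials, MvPolynomial.smul_monomial, smul_eq_mul, mul_one]
    rw [h1, map_smul, Basis.repr_self, Finsupp.smul_single, smul_eq_mul, mul_one]
  have h2 : (Finsupp.curryLinearEquiv k).symm (Finsupp.single i (Finsupp.single e r)) =
      (Finsupp.single (i, e) r : ι × (Fin t →₀ ℕ) →₀ k) := by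
    rw [LinearEquiv.symm_apply_eq]
    simp
  simp [latticeCoeffs, h, h2, Finsupp.mapDomain_single]

theorem latticeCoeffs_X_smul {ι : Type*} {t : ℕ} (j : Fin t) (p : ι →₀ MvPolynomial (Fin t) k) :
    latticeCoeffs k ι t ((MvPolynomial.X j : MvPolynomial (Fin t) k) • p) =
      shiftOp (k := k) (fun _ => LinearMap.id) j 1 (latticeCoeffs k ι t p) := by
  induction p using Finsupp.induction_linear with
  | zero => simp
  | add f g hf hg => simp only [smul_add, map_add, hf, hg]
  | single i q =>
    induction q using MvPolynomial.induction_on' with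
    | add f g hf hg => simp only [Finsupp.single_add, smul_add, map_add, hf, hg]
    | monomial e r =>
      rw [Finsupp.smul_single, smul_eq_mul, MvPolynomial.X, MvPolynomial.monomial_mul,
        latticeCoeffs_single_monomial, latticeCoeffs_single_monomial, shiftOp_single, one_mul]
      congr 1
      ext l
      by_cases h : l = j
      · subst h
        simp [add_comm]
      · simp [h]

/-- A common denominator for the elements of a finite-dimensional subspace. -/
theorem exists_smul_mem_of_fg {R M : Type*} [CommRing R] [IsDomain R] [AddCommGroup M] [Module R M]
    [Module k M] [Algebra k R] [IsScalarTower k R M] {N : Submodule R M}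
    (hN : ∀ m : M, ∃ a : R, a ≠ 0 ∧ a • m ∈ N) (W : Submodule k M) [hW : FiniteDimensional k W] :
    ∃ a : R, a ≠ 0 ∧ ∀ m ∈ W, a • m ∈ N := by
  obtain ⟨s, rfl⟩ := (Submodule.fg_iff_finiteDimensional W).2 hW
  choose a ha haN using hN
  refine ⟨∏ m ∈ s, a m, Finset.prod_ne_zero_iff.2 fun m _ => ha m, fun m hm => ?_⟩
  induction hm using Submodule.span_induction with
  | mem x hx =>
    classical
    rw [← Finset.prod_erase_mul s a hx, mul_smul]
    exact N.smul_mem _ (haN x)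
  | zero => simp
  | add x y _ _ hx hy => rw [smul_add]; exact N.add_mem hx hy
  | smul r x _ hx =>
    rw [← algebraMap_smul R r x, smul_comm]
    exact N.smul_mem _ hx

/-- A finite-dimensional subspace of `D` can be multiplied into a free module over the polynomial
ring, where multiplication by the variables acts by shifts. -/
theorem expands_mulLeft {t : ℕ} (g : MvPolynomial (Fin t) k →ₐ[k] D) (hg : Function.Injective g) :
    Expands k (Set.range fun j : Fin t => LinearMap.mulLeft k (g (MvPolynomial.X j))) t := by
  let : Algebra (MvPolynomial (Fin t) k) D := g.toRingHom.toAlgebra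
  have hsmul : ∀ (p : MvPolynomial (Fin t) k) (x : D), p • x = g p * x := fun _ _ => rfl
  have : IsScalarTower k (MvPolynomial (Fin t) k) D := ⟨fun r p x => by
    rw [hsmul, hsmul, map_smul, smul_mul_assoc]⟩
  obtain ⟨s, hs, hmax⟩ := exists_maximal_linearIndepOn (MvPolynomial (Fin t) k) (id : D → D)
  have hs : LinearIndependent (MvPolynomial (Fin t) k) ((↑) : s → D) := hs
  set N := Submodule.span (MvPolynomial (Fin t) k) (Set.range ((↑) : s → D)) with hN
  have htors : ∀ x : D, ∃ a : MvPolynomial (Fin t) k, a ≠ 0 ∧ a • x ∈ N := by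
    intro x
    by_cases hx : x ∈ s
    · exact ⟨1, one_ne_zero, by rw [one_smul]; exact Submodule.subset_span ⟨⟨x, hx⟩, rfl⟩⟩
    · obtain ⟨a, ha, hax⟩ := hmax x hx
      refine ⟨a, ha, ?_⟩
      rw [hN, Subtype.range_coe]
      simpa using hax
  have h := Expands.finsupp (n := t) (Or.inl rfl : Expands k (∅ : Set (End k (s →₀ k))) 0)
    (fun _ _ => LinearMap.id) (fun _ _ => Function.injective_id)
  rw [zero_add, Set.image_empty, Set.empty_union] at h
  refine h.of_local fun W hW => ?_
  obtain ⟨a, ha, haW⟩ := exists_smul_mem_of_fg htors W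
  -- Clear denominators, then take coordinates with respect to the independent family.
  let μ : W →ₗ[k] N :=
    { toFun := fun m => ⟨a • (m : D), haW m m.2⟩
      map_add' := fun m m' => Subtype.ext (smul_add a (m : D) m')
      map_smul' := fun r m => Subtype.ext (smul_comm a r (m : D)) }
  let φ : W →ₗ[k] ((Fin t → ℤ) →₀ (s →₀ k)) :=
    latticeCoeffs k s t ∘ₗ (hs.repr.restrictScalars k) ∘ₗ μ
  refine ⟨φ, ?_, ?_⟩
  · rw [LinearMap.coe_comp, LinearMap.coe_comp]
    refine (latticeCoeffs_injective k s t).comp (Function.Injective.comp ?_ ?_)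
    · have h1 : Function.Injective hs.repr := LinearMap.ker_eq_bot.1 hs.repr_ker
      exact h1
    · intro m m' (hmm : μ m = μ m')
      have h1 : g a * m = g a * m' := congrArg Subtype.val hmm
      exact Subtype.ext (mul_left_cancel₀ (fun h0 => ha (hg (by rw [h0, map_zero]))) h1)
  · rintro _ ⟨j, rfl⟩
    refine ⟨_, ⟨j, rfl⟩, fun m m' hm => ?_⟩
    have h1 : μ m' = ((MvPolynomial.X j : MvPolynomial (Fin t) k) • (μ m : N) : N) := by
      apply Subtype.ext
      change g a * m' = g (MvPolynomial.X j) * (g a * m)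
      rw [hm]
      rw [ LinearMap.mulLeft_apply, mul_left_comm]
    change latticeCoeffs k s t (hs.repr (μ m')) = shiftOp _ j 1 (latticeCoeffs k s t (hs.repr (μ m)))
    rw [h1, map_smul, latticeCoeffs_X_smul]

end Commutative

/-! ### The lattice module of a generalized Weyl algebra -/

namespace GWAData

section Generators

variable {k D : Type*} [Field k] [Ring D] [Algebra k D] {n : ℕ} (w : GWAData k D n)

/-- The structure map `D → D(a, σ)`. -/
def coeffHom : D →ₐ[k] GWA w where
  toFun d := RingQuot.mkAlgHom k (Rel w) (co k d)
  map_one' := by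
    have h := RingQuot.mkAlgHom_rel k (Rel.co_algebraMap (w := w) 1)
    simpa using h
  map_zero' := by
    have h := RingQuot.mkAlgHom_rel k (Rel.co_algebraMap (w := w) 0)
    simpa using h
  map_mul' d e := by
    rw [← map_mul]
    exact RingQuot.mkAlgHom_rel k (Rel.co_mul d e)
  map_add' d e := by
    rw [← map_add]
    exact RingQuot.mkAlgHom_rel k (Rel.co_add d e)
  commutes' r := by
    rw [RingQuot.mkAlgHom_rel k (Rel.co_algebraMap (w := w) r), AlgHom.commutes]

/-- The generator `X_i⁺` of `D(a, σ)`. -/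
def xPos (i : Fin n) : GWA w := RingQuot.mkAlgHom k (Rel w) (xp k D i)

/-- The generator `X_i⁻` of `D(a, σ)`. -/
def xNeg (i : Fin n) : GWA w := RingQuot.mkAlgHom k (Rel w) (xm k D i)

theorem xPos_mul_coeff (i : Fin n) (d : D) :
    w.xPos i * w.coeffHom d = w.coeffHom (w.σ i d) * w.xPos i := by
  have h := RingQuot.mkAlgHom_rel k (Rel.xp_co (w := w) i d)
  rwa [map_mul, map_mul] at h

theorem xNeg_mul_coeff (i : Fin n) (d : D) :
    w.xNeg i * w.coeffHom d = w.coeffHom ((w.σ i).symm d) * w.xNeg i := by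
  have h := RingQuot.mkAlgHom_rel k (Rel.xm_co (w := w) i d)
  rwa [map_mul, map_mul] at h

theorem xNeg_mul_xPos (i : Fin n) : w.xNeg i * w.xPos i = w.coeffHom (w.a i) := by
  have h := RingQuot.mkAlgHom_rel k (Rel.xm_xp (w := w) i)
  rwa [map_mul] at h

theorem xPos_mul_xNeg (i : Fin n) : w.xPos i * w.xNeg i = w.coeffHom (w.σ i (w.a i)) := by
  have h := RingQuot.mkAlgHom_rel k (Rel.xp_xm (w := w) i)
  rwa [map_mul] at h

theorem commute_xNeg_xPos {i j : Fin n} (h : i ≠ j) : Commute (w.xNeg i) (w.xPos j) := by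
  have h := RingQuot.mkAlgHom_rel k (Rel.xm_xp_comm (w := w) i j h)
  rwa [map_mul, map_mul] at h

theorem commute_xNeg_xNeg {i j : Fin n} (h : i ≠ j) : Commute (w.xNeg i) (w.xNeg j) := by
  have h := RingQuot.mkAlgHom_rel k (Rel.xm_xm_comm (w := w) i j h)
  rwa [map_mul, map_mul] at h

theorem commute_xPos_xPos {i j : Fin n} (h : i ≠ j) : Commute (w.xPos i) (w.xPos j) := by
  have h := RingQuot.mkAlgHom_rel k (Rel.xp_xp_comm (w := w) i j h)
  rwa [map_mul, map_mul] at h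

theorem induction_on {P : GWA w → Prop} (coeff : ∀ d, P (w.coeffHom d)) (pos : ∀ i, P (w.xPos i))
    (neg : ∀ i, P (w.xNeg i)) (add : ∀ r s, P r → P s → P (r + s))
    (mul : ∀ r s, P r → P s → P (r * s)) (r : GWA w) : P r := by
  obtain ⟨x, rfl⟩ := RingQuot.mkAlgHom_surjective k (Rel w) r
  induction x using FreeAlgebra.induction with
  | grade0 c =>
    rw [AlgHom.commutes, ← w.coeffHom.commutes]
    exact coeff _
  | grade1 g =>
    cases g with
    | coeff d => exact coeff d
    | xp i => exact pos i
    | xm i => exact neg i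
  | add x y hx hy => rw [map_add]; exact add _ _ hx hy
  | mul x y hx hy => rw [map_mul]; exact mul _ _ hx hy

/-- The element `X_i^(p)`: the power `(X_i⁺)^p` for `p ≥ 0` and `(X_i⁻)^(-p)` for `p < 0`. -/
def xPow (i : Fin n) (p : ℤ) : GWA w :=
  if 0 ≤ p then w.xPos i ^ p.toNat else w.xNeg i ^ (-p).toNat

theorem xPow_natCast (i : Fin n) (m : ℕ) : w.xPow i m = w.xPos i ^ m := by simp [xPow]

theorem xPow_neg_natCast (i : Fin n) (m : ℕ) : w.xPow i (-m) = w.xNeg i ^ m := by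
  rcases m with _ | m
  · simp [xPow]
  · rw [xPow, if_neg (by push_cast; omega), neg_neg, Int.toNat_natCast]

/-- The coefficient `c` in `X_i⁺ X_i^(p) = c X_i^(p + 1)`. -/
def posCoeff (i : Fin n) (p : ℤ) : D := if 0 ≤ p then 1 else w.σ i (w.a i)

/-- The coefficient `c` in `X_i⁻ X_i^(p) = c X_i^(p - 1)`. -/
def negCoeff (i : Fin n) (p : ℤ) : D := if p ≤ 0 then 1 else w.a i

theorem xPos_mul_xPow (i : Fin n) (p : ℤ) :
    w.xPos i * w.xPow i p = w.coeffHom (w.posCoeff i p) * w.xPow i (p + 1) := by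
  by_cases h : 0 ≤ p
  · obtain ⟨m, rfl⟩ := Int.eq_ofNat_of_zero_le h
    rw [posCoeff, if_pos h, map_one, one_mul, xPow_natCast, ← pow_succ', ← xPow_natCast]
    rfl
  · obtain ⟨m, rfl⟩ : ∃ m : ℕ, p = -((m + 1 : ℕ) : ℤ) := ⟨(-p - 1).toNat, by push_cast; omega⟩
    rw [posCoeff, if_neg h, xPow_neg_natCast, pow_succ', ← mul_assoc, xPos_mul_xNeg]
    rw [show -((m + 1 : ℕ) : ℤ) + 1 = -(m : ℤ) by push_cast; ring, xPow_neg_natCast]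

theorem xNeg_mul_xPow (i : Fin n) (p : ℤ) :
    w.xNeg i * w.xPow i p = w.coeffHom (w.negCoeff i p) * w.xPow i (p - 1) := by
  by_cases h : p ≤ 0
  · obtain ⟨m, rfl⟩ : ∃ m : ℕ, p = -(m : ℤ) := ⟨(-p).toNat, by omega⟩
    rw [negCoeff, if_pos h, map_one, one_mul, xPow_neg_natCast, ← pow_succ', ← xPow_neg_natCast]
    congr 1
    push_cast
    ring
  · obtain ⟨m, rfl⟩ : ∃ m : ℕ, p = ((m + 1 : ℕ) : ℤ) := ⟨(p - 1).toNat, by push_cast; omega⟩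
    rw [negCoeff, if_neg h, xPow_natCast, pow_succ', ← mul_assoc, xNeg_mul_xPos]
    rw [show ((m + 1 : ℕ) : ℤ) - 1 = (m : ℤ) by push_cast; ring, xPow_natCast]

theorem commute_xPow {i j : Fin n} (h : i ≠ j) (p q : ℤ) :
    Commute (w.xPow i p) (w.xPow j q) := by
  unfold xPow
  split_ifs
  · exact (w.commute_xPos_xPos h).pow_pow _ _
  · exact ((w.commute_xNeg_xPos h.symm).pow_pow _ _).symm
  · exact (w.commute_xNeg_xPos h).pow_pow _ _
  · exact (w.commute_xNeg_xNeg h).pow_pow _ _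

theorem pairwise_commute_xPow (s : Finset (Fin n)) (α : Fin n → ℤ) :
    (s : Set (Fin n)).Pairwise (Function.onFun Commute fun i => w.xPow i (α i)) :=
  fun _ _ _ _ h => w.commute_xPow h _ _

/-- The monomial `X^α = ∏_i X_i^(α i)`. -/
def xMonomial (α : Fin n → ℤ) : GWA w :=
  Finset.univ.noncommProd (fun i => w.xPow i (α i)) (w.pairwise_commute_xPow _ α)

theorem xMonomial_zero : w.xMonomial 0 = 1 := by
  rw [xMonomial, Finset.noncommProd_eq_pow_card _ _ _ 1 (fun i _ => by simp [xPow]), one_pow]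

/-- The factor `X_i` can be split off from a monomial, the cofactor not depending on its exponent. -/
theorem exists_xMonomial_eq (α : Fin n → ℤ) (i : Fin n) : ∃ r : GWA w, ∀ δ : ℤ,
    w.xMonomial (α + Pi.single i δ) = w.xPow i (α i + δ) * r := by
  classical
  refine ⟨(Finset.univ.erase i).noncommProd (fun j => w.xPow j (α j))
    (w.pairwise_commute_xPow _ α), fun δ => ?_⟩
  rw [xMonomial, ← Finset.mul_noncommProd_erase _ (Finset.mem_univ i)]
  congr 1
  · simp
  · refine Finset.noncommProd_congr rfl (fun j hj => ?_) _
    rw [Pi.add_apply, Pi.single_eq_of_ne (Finset.ne_of_mem_erase hj), add_zero]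

theorem xPos_mul_xMonomial (i : Fin n) (α : Fin n → ℤ) : w.xPos i * w.xMonomial α =
    w.coeffHom (w.posCoeff i (α i)) * w.xMonomial (α + Pi.single i 1) := by
  obtain ⟨r, hr⟩ := w.exists_xMonomial_eq α i
  have h0 := hr 0
  rw [Pi.single_zero, add_zero, add_zero] at h0
  rw [hr, h0, ← mul_assoc, xPos_mul_xPow, mul_assoc]

theorem xNeg_mul_xMonomial (i : Fin n) (α : Fin n → ℤ) : w.xNeg i * w.xMonomial α =
    w.coeffHom (w.negCoeff i (α i)) * w.xMonomial (α + Pi.single i (-1)) := by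
  obtain ⟨r, hr⟩ := w.exists_xMonomial_eq α i
  have h0 := hr 0
  rw [Pi.single_zero, add_zero, add_zero] at h0
  rw [hr, h0, ← mul_assoc, xNeg_mul_xPow, mul_assoc, sub_eq_add_neg]

end Generators

section Representation

variable {k D : Type*} [Field k] [CommRing D] [Algebra k D] {n : ℕ} (w : GWAData k D n)

theorem σ_symm_comm (i j : Fin n) (d : D) :
    (w.σ i).symm (w.σ j d) = w.σ j ((w.σ i).symm d) := by
  rw [AlgEquiv.symm_apply_eq, w.σ_comm, AlgEquiv.apply_symm_apply]

theorem σ_symm_symm_comm (i j : Fin n) (d : D) :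
    (w.σ i).symm ((w.σ j).symm d) = (w.σ j).symm ((w.σ i).symm d) := by
  rw [AlgEquiv.symm_apply_eq, ← w.σ_symm_comm, AlgEquiv.apply_symm_apply]

/-- The action of `X_i⁺` in degree `p`: `X_i⁺ (e X^α) = posAct i (α i) e X^(α + ε_i)`. -/
def posAct (i : Fin n) (p : ℤ) : End k D :=
  LinearMap.mulLeft k (w.posCoeff i p) ∘ₗ (w.σ i).toLinearMap

/-- The action of `X_i⁻` in degree `p`: `X_i⁻ (e X^α) = negAct i (α i) e X^(α - ε_i)`. -/
def negAct (i : Fin n) (p : ℤ) : End k D :=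
  LinearMap.mulLeft k (w.negCoeff i p) ∘ₗ (w.σ i).symm.toLinearMap

@[simp]
theorem posAct_apply (i : Fin n) (p : ℤ) (e : D) :
    w.posAct i p e = w.posCoeff i p * w.σ i e := rfl

@[simp]
theorem negAct_apply (i : Fin n) (p : ℤ) (e : D) :
    w.negAct i p e = w.negCoeff i p * (w.σ i).symm e := rfl

/-- The action of the generators of `D(a, σ)` on the free `D`-module with basis `ℤⁿ`. -/
def genAct : GWAGen D n → End k ((Fin n → ℤ) →₀ D)
  | .coeff d => Finsupp.mapRange.linearMap (LinearMap.mulLeft k d)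
  | .xp i => shiftOp (w.posAct i) i 1
  | .xm i => shiftOp (w.negAct i) i (-1)

theorem genAct_coeff_single (d e : D) (α : Fin n → ℤ) :
    w.genAct (.coeff d) (Finsupp.single α e) = Finsupp.single α (d * e) := by
  simp [genAct]

theorem genAct_xp_single (i : Fin n) (e : D) (α : Fin n → ℤ) :
    w.genAct (.xp i) (Finsupp.single α e) =
      Finsupp.single (α + Pi.single i 1) (w.posCoeff i (α i) * w.σ i e) := by
  simp [genAct]

theorem genAct_xm_single (i : Fin n) (e : D) (α : Fin n → ℤ) :
    w.genAct (.xm i) (Finsupp.single α e) =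
      Finsupp.single (α + Pi.single i (-1)) (w.negCoeff i (α i) * (w.σ i).symm e) := by
  simp [genAct]

theorem σ_posCoeff {i j : Fin n} (h : j ≠ i) (p : ℤ) :
    w.σ i (w.posCoeff j p) = w.posCoeff j p := by
  unfold posCoeff
  split_ifs
  · simp
  · rw [w.σ_comm, w.σ_a i j h]

theorem σ_negCoeff {i j : Fin n} (h : j ≠ i) (p : ℤ) :
    w.σ i (w.negCoeff j p) = w.negCoeff j p := by
  unfold negCoeff
  split_ifs
  · simp
  · rw [w.σ_a i j h]

theorem σ_symm_posCoeff {i j : Fin n} (h : j ≠ i) (p : ℤ) :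
    (w.σ i).symm (w.posCoeff j p) = w.posCoeff j p := by
  rw [AlgEquiv.symm_apply_eq, w.σ_posCoeff h]

theorem σ_symm_negCoeff {i j : Fin n} (h : j ≠ i) (p : ℤ) :
    (w.σ i).symm (w.negCoeff j p) = w.negCoeff j p := by
  rw [AlgEquiv.symm_apply_eq, w.σ_negCoeff h]

/-- The operators `genAct` satisfy the defining relations of `D(a, σ)`. -/
theorem lift_genAct_rel ⦃x y : FreeAlgebra k (GWAGen D n)⦄ (h : Rel w x y) :
    FreeAlgebra.lift k w.genAct x = FreeAlgebra.lift k w.genAct y := by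
  refine Finsupp.lhom_ext fun α e => ?_
  cases h with
  | co_add d e' =>
    simp only [co, map_add, FreeAlgebra.lift_ι_apply, LinearMap.add_apply, genAct_coeff_single,
      add_mul, Finsupp.single_add]
  | co_mul d e' =>
    simp only [co, map_mul, FreeAlgebra.lift_ι_apply, Module.End.mul_apply, genAct_coeff_single,
      mul_assoc]
  | co_algebraMap r =>
    simp only [co, AlgHom.commutes, FreeAlgebra.lift_ι_apply, Module.algebraMap_end_apply,
      genAct_coeff_single, Finsupp.smul_single, Algebra.smul_def]
  | xp_co i d =>
    simp only [co, xp, map_mul, FreeAlgebra.lift_ι_apply, Module.End.mul_apply,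
      genAct_coeff_single, genAct_xp_single, mul_left_comm]
  | xm_co i d =>
    simp only [co, xm, map_mul, FreeAlgebra.lift_ι_apply, Module.End.mul_apply,
      genAct_coeff_single, genAct_xm_single, mul_left_comm]
  | xm_xp i =>
    simp only [co, xm, xp, map_mul, FreeAlgebra.lift_ι_apply, Module.End.mul_apply,
      genAct_coeff_single, genAct_xm_single, genAct_xp_single, Pi.add_apply, Pi.single_eq_same,
      AlgEquiv.symm_apply_apply]
    rw [add_assoc, ← Pi.single_add, add_neg_cancel, Pi.single_zero, add_zero]
    congr 1
    by_cases h : 0 ≤ α i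
    · rw [posCoeff, negCoeff, if_pos h, if_neg (by omega), map_one, one_mul]
    · rw [posCoeff, negCoeff, if_neg h, if_pos (by omega), AlgEquiv.symm_apply_apply, one_mul]
  | xp_xm i =>
    simp only [co, xm, xp, map_mul, FreeAlgebra.lift_ι_apply, Module.End.mul_apply,
      genAct_coeff_single, genAct_xm_single, genAct_xp_single, Pi.add_apply, Pi.single_eq_same,
      AlgEquiv.apply_symm_apply]
    rw [add_assoc, ← Pi.single_add, neg_add_cancel, Pi.single_zero, add_zero]
    congr 1
    by_cases h : α i ≤ 0
    · rw [posCoeff, negCoeff, if_pos h, if_neg (by omega), map_one, one_mul]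
    · rw [posCoeff, negCoeff, if_neg h, if_pos (by omega), one_mul]
  | xm_xp_comm i j h =>
    simp only [xm, xp, map_mul, FreeAlgebra.lift_ι_apply, Module.End.mul_apply,
      genAct_xm_single, genAct_xp_single, Pi.add_apply, Pi.single_eq_of_ne h,
      Pi.single_eq_of_ne h.symm, add_zero, w.σ_symm_posCoeff h.symm, w.σ_negCoeff h,
      w.σ_symm_comm]
    rw [add_right_comm, mul_left_comm]
  | xm_xm_comm i j h =>
    simp only [xm, map_mul, FreeAlgebra.lift_ι_apply, Module.End.mul_apply,
      genAct_xm_single, Pi.add_apply, Pi.single_eq_of_ne h,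
      Pi.single_eq_of_ne h.symm, add_zero, w.σ_symm_negCoeff h.symm, w.σ_symm_negCoeff h]
    rw [add_right_comm, mul_left_comm, w.σ_symm_symm_comm]
  | xp_xp_comm i j h =>
    simp only [xp, map_mul, FreeAlgebra.lift_ι_apply, Module.End.mul_apply,
      genAct_xp_single, Pi.add_apply, Pi.single_eq_of_ne h,
      Pi.single_eq_of_ne h.symm, add_zero, w.σ_posCoeff h.symm, w.σ_posCoeff h]
    rw [add_right_comm, mul_left_comm, w.σ_comm]

/-- The representation of `D(a, σ)` on the free `D`-module with basis `ℤⁿ`. -/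
def rep : GWA w →ₐ[k] End k ((Fin n → ℤ) →₀ D) :=
  RingQuot.liftAlgHom k ⟨FreeAlgebra.lift k w.genAct, w.lift_genAct_rel⟩

theorem rep_coeff (d : D) : w.rep (w.coeffHom d) = w.genAct (.coeff d) := by
  change RingQuot.liftAlgHom k _ (RingQuot.mkAlgHom k _ _) = _
  rw [RingQuot.liftAlgHom_mkAlgHom_apply]
  exact FreeAlgebra.lift_ι_apply _ _

theorem rep_xPos (i : Fin n) : w.rep (w.xPos i) = w.genAct (.xp i) := by
  change RingQuot.liftAlgHom k _ (RingQuot.mkAlgHom k _ _) = _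
  rw [RingQuot.liftAlgHom_mkAlgHom_apply]
  exact FreeAlgebra.lift_ι_apply _ _

theorem rep_xNeg (i : Fin n) : w.rep (w.xNeg i) = w.genAct (.xm i) := by
  change RingQuot.liftAlgHom k _ (RingQuot.mkAlgHom k _ _) = _
  rw [RingQuot.liftAlgHom_mkAlgHom_apply]
  exact FreeAlgebra.lift_ι_apply _ _

/-- The map `e X^α ↦ e X^α` from the lattice module to `D(a, σ)`. -/
def ofLattice : ((Fin n → ℤ) →₀ D) →ₗ[k] GWA w :=
  Finsupp.lsum k fun α => LinearMap.mulRight k (w.xMonomial α) ∘ₗ w.coeffHom.toLinearMap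

theorem ofLattice_single (α : Fin n → ℤ) (e : D) :
    w.ofLattice (Finsupp.single α e) = w.coeffHom e * w.xMonomial α := by
  simp [ofLattice]

/-- The map `ofLattice` is `D(a, σ)`-linear. -/
theorem ofLattice_rep (r : GWA w) (m : (Fin n → ℤ) →₀ D) :
    w.ofLattice (w.rep r m) = r * w.ofLattice m := by
  induction r using w.induction_on generalizing m with
  | coeff d =>
    induction m using Finsupp.induction_linear with
    | zero => simp
    | add f g hf hg => simp only [map_add, mul_add, hf, hg]
    | single α e =>
      rw [rep_coeff, genAct_coeff_single, ofLattice_single, ofLattice_single, map_mul, mul_assoc]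
  | pos i =>
    induction m using Finsupp.induction_linear with
    | zero => simp
    | add f g hf hg => simp only [map_add, mul_add, hf, hg]
    | single α e =>
      rw [rep_xPos, genAct_xp_single, ofLattice_single, ofLattice_single, ← mul_assoc,
        xPos_mul_coeff, mul_assoc, xPos_mul_xMonomial, ← mul_assoc, ← map_mul,
        mul_comm (w.posCoeff _ _)]
  | neg i =>
    induction m using Finsupp.induction_linear with
    | zero => simp
    | add f g hf hg => simp only [map_add, mul_add, hf, hg]
    | single α e =>
      rw [rep_xNeg, genAct_xm_single, ofLattice_single, ofLattice_single, ← mul_assoc,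
        xNeg_mul_coeff, mul_assoc, xNeg_mul_xMonomial, ← mul_assoc, ← map_mul,
        mul_comm (w.negCoeff _ _)]
  | add r s hr hs => rw [map_add, LinearMap.add_apply, map_add, hr, hs, add_mul]
  | mul r s hr hs => rw [map_mul, Module.End.mul_apply, hr, hs, mul_assoc]

/-- The map `r ↦ r · X^0` from `D(a, σ)` to the lattice module. -/
def toLattice : GWA w →ₗ[k] ((Fin n → ℤ) →₀ D) :=
  LinearMap.applyₗ (Finsupp.single 0 1) ∘ₗ w.rep.toLinearMap

theorem toLattice_mul (r s : GWA w) : w.toLattice (r * s) = w.rep r (w.toLattice s) := by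
  simp [toLattice]

theorem toLattice_injective : Function.Injective w.toLattice := by
  refine Function.LeftInverse.injective (g := w.ofLattice) fun r => ?_
  change w.ofLattice (w.rep r (Finsupp.single 0 1)) = r
  rw [ofLattice_rep, ofLattice_single, map_one, one_mul, xMonomial_zero, mul_one]

theorem toLattice_one : w.toLattice 1 = Finsupp.single 0 1 := by
  simp [toLattice]

theorem nontrivial_gwa [Nontrivial D] : Nontrivial (GWA w) :=
  ⟨1, 0, fun h => by
    have := congrArg w.toLattice h
    rw [toLattice_one, map_zero, Finsupp.single_eq_zero] at this
    exact one_ne_zero this⟩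

end Representation

end GWAData

/-! ### Growth exponents -/

section Growth

open scoped Topology

/-- The polynomial growth exponent `limsup_m log f(m) / log m`. -/
def growthExponent (f : ℕ → ℕ) : ℝ≥0∞ :=
  limsup (fun m : ℕ => ENNReal.ofReal (Real.log (f m) / Real.log m)) atTop

theorem tendsto_log_natCast : Tendsto (fun m : ℕ => Real.log m) atTop atTop :=
  Real.tendsto_log_atTop.comp tendsto_natCast_atTop_atTop

theorem growthExponent_le {F G : ℕ → ℕ} {C t : ℕ} (hF : ∀ m, 0 < F m)
    (h : ∀ m, 1 ≤ m → F m ≤ C * m ^ t * G m) : growthExponent F ≤ t + growthExponent G := by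
  have h0 : Tendsto (fun m : ℕ => ENNReal.ofReal (Real.log C / Real.log m)) atTop (𝓝 0) := by
    rw [← ENNReal.ofReal_zero]
    exact ENNReal.tendsto_ofReal (tendsto_log_natCast.const_div_atTop _)
  calc growthExponent F
    _ ≤ limsup ((fun m : ℕ => (t : ℝ≥0∞) + ENNReal.ofReal (Real.log (G m) / Real.log m)) +
          fun m : ℕ => ENNReal.ofReal (Real.log C / Real.log m)) atTop := by
        refine limsup_le_limsup ?_
        filter_upwards [eventually_gt_atTop 1] with m hm
        have hm1 : (1 : ℝ) < m := by exact_mod_cast hm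
        have hlog : 0 < Real.log m := Real.log_pos hm1
        have hpos := (hF m).trans_le (h m hm.le)
        have hG : (G m : ℝ) ≠ 0 := by
          exact_mod_cast (Nat.pos_of_mul_pos_left hpos).ne'
        have hC : (C : ℝ) ≠ 0 := by
          exact_mod_cast (Nat.pos_of_mul_pos_right (Nat.pos_of_mul_pos_right hpos)).ne'
        have h1 : Real.log (F m) ≤ Real.log C + t * Real.log m + Real.log (G m) := by
          rw [← Real.log_pow, ← Real.log_mul hC (by positivity), ← Real.log_mul (by positivity) hG]
          exact Real.log_le_log (by exact_mod_cast hF m) (by exact_mod_cast h m hm.le)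
        have h2 : Real.log (F m) / Real.log m ≤
            t + Real.log (G m) / Real.log m + Real.log C / Real.log m := by
          rw [div_le_iff₀ hlog]
          have : (t + Real.log (G m) / Real.log m + Real.log C / Real.log m) * Real.log m =
            Real.log C + t * Real.log m + Real.log (G m) := by field_simp; ring
          rw [this]
          exact h1
        refine (ENNReal.ofReal_le_ofReal h2).trans (ENNReal.ofReal_add_le.trans ?_)
        refine add_le_add (ENNReal.ofReal_add_le.trans ?_) le_rfl
        rw [ENNReal.ofReal_natCast]
    _ = t + growthExponent G := by
        rw [ENNReal.limsup_add_of_right_tendsto_zero h0,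
          limsup_const_add _ _ _ (by isBoundedDefault) (by isBoundedDefault)]
        rfl

theorem growthExponent_one : growthExponent (fun _ => 1) = 0 := by
  simp [growthExponent]

theorem le_growthExponent {f : ℕ → ℕ} {δ d : ℝ} (hδ : 0 < δ)
    (h : ∀ m : ℕ, 1 ≤ m → δ * (m : ℝ) ^ d ≤ f m) : ENNReal.ofReal d ≤ growthExponent f := by
  have h0 : Tendsto (fun m : ℕ => ENNReal.ofReal (Real.log δ / Real.log m + d)) atTop
      (𝓝 (ENNReal.ofReal d)) := by
    refine ENNReal.tendsto_ofReal ?_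
    simpa using (tendsto_log_natCast.const_div_atTop (Real.log δ)).add_const d
  rw [← h0.limsup_eq]
  refine limsup_le_limsup ?_
  filter_upwards [eventually_gt_atTop 1] with m hm
  have hm1 : (1 : ℝ) < m := by exact_mod_cast hm
  have hm0 : (0 : ℝ) < m := by linarith
  have hlog : 0 < Real.log m := Real.log_pos hm1
  refine ENNReal.ofReal_le_ofReal ?_
  rw [div_add' _ _ _ hlog.ne']
  refine div_le_div_of_nonneg_right ?_ hlog.le
  rw [← Real.log_rpow hm0, ← Real.log_mul hδ.ne' (by positivity)]
  exact Real.log_le_log (by positivity) (h m hm.le)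

/-- The difference inequality `f(m + 1) - f(m) ≥ c f(m)^((d - 1) / d)` forces growth of order
`m ^ d`, as `x ↦ x + c x^((d - 1) / d)` is monotone and `(m + 1)^d - m^d = O(m^(d - 1))`. -/
theorem exists_mul_rpow_le_of_add_rpow_le {f : ℕ → ℕ} {c d : ℝ} (hc : 0 < c) (hd : 1 ≤ d)
    (hf0 : 0 < f 0)
    (hf : ∀ m, (f m : ℝ) + c * (f m : ℝ) ^ ((d - 1) / d) ≤ f (m + 1)) :
    ∃ δ : ℝ, 0 < δ ∧ ∀ m : ℕ, 1 ≤ m → δ * (m : ℝ) ^ d ≤ f m := by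
  have hd0 : 0 < d := by linarith
  set ε : ℝ := min 1 (c / (d * 2 ^ (d - 1))) with hε
  have hε0 : 0 < ε := lt_min one_pos (by positivity)
  refine ⟨ε ^ d, by positivity, fun m hm => ?_⟩
  induction m, hm using Nat.le_induction with
  | base =>
    have h1 : (1 : ℝ) ≤ f 0 := by exact_mod_cast hf0
    have h2 : ε ^ d ≤ 1 := Real.rpow_le_one hε0.le (min_le_left _ _) hd0.le
    have h3 : 0 ≤ c * (f 0 : ℝ) ^ ((d - 1) / d) := by positivity
    have h4 := hf 0
    simp only [Nat.cast_one, Real.one_rpow, mul_one, zero_add] at h4 ⊢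
    linarith
  | succ m hm ih =>
    have hm1 : (1 : ℝ) ≤ m := by exact_mod_cast hm
    have hm0 : (0 : ℝ) < m := by linarith
    have h1 : (ε ^ d * (m : ℝ) ^ d) ^ ((d - 1) / d) ≤ (f m : ℝ) ^ ((d - 1) / d) :=
      Real.rpow_le_rpow (by positivity) ih (div_nonneg (by linarith) hd0.le)
    have h2 : (ε ^ d * (m : ℝ) ^ d) ^ ((d - 1) / d) = ε ^ (d - 1) * (m : ℝ) ^ (d - 1) := by
      rw [Real.mul_rpow (by positivity) (by positivity), ← Real.rpow_mul hε0.le,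
        ← Real.rpow_mul hm0.le, mul_div_cancel₀ _ hd0.ne']
    have h3 : ((m : ℝ) + 1) ^ d ≤ (m : ℝ) ^ d + d * ((m : ℝ) + 1) ^ (d - 1) := by
      have hb := one_add_mul_self_le_rpow_one_add (s := -1 / ((m : ℝ) + 1))
        (by rw [le_div_iff₀ (by positivity)]; linarith) hd
      have hb1 : 1 + -1 / ((m : ℝ) + 1) = m / (m + 1) := by field_simp; ring
      rw [hb1, Real.div_rpow hm0.le (by positivity), le_div_iff₀ (by positivity)] at hb
      have hb2 : ((m : ℝ) + 1) ^ d = ((m : ℝ) + 1) ^ (d - 1) * (m + 1) := by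
        rw [← Real.rpow_add_one (by positivity), sub_add_cancel]
      have hb3 : (1 + d * (-1 / ((m : ℝ) + 1))) * ((m : ℝ) + 1) ^ d =
          ((m : ℝ) + 1) ^ d - d * ((m : ℝ) + 1) ^ (d - 1) := by
        rw [hb2]
        field_simp
        ring
      linarith
    have h4 : ((m : ℝ) + 1) ^ (d - 1) ≤ 2 ^ (d - 1) * (m : ℝ) ^ (d - 1) := by
      rw [← Real.mul_rpow (by norm_num) hm0.le]
      exact Real.rpow_le_rpow (by positivity) (by linarith) (by linarith)
    have h5 : ε ^ d * (d * 2 ^ (d - 1)) ≤ c * ε ^ (d - 1) := by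
      have h6 : ε * (d * 2 ^ (d - 1)) ≤ c := by
        rw [← le_div_iff₀ (by positivity)]
        exact min_le_right _ _
      have h7 : ε ^ d = ε ^ (d - 1) * ε := by
        rw [← Real.rpow_add_one hε0.ne', sub_add_cancel]
      calc _ = ε ^ (d - 1) * (ε * (d * 2 ^ (d - 1))) := by rw [h7]; ring
        _ ≤ ε ^ (d - 1) * c := by gcongr
        _ = _ := mul_comm _ _
    push_cast
    calc ε ^ d * ((m : ℝ) + 1) ^ d
      _ ≤ ε ^ d * ((m : ℝ) ^ d + d * (2 ^ (d - 1) * (m : ℝ) ^ (d - 1))) := by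
          gcongr
          exact h3.trans (by gcongr)
      _ = ε ^ d * (m : ℝ) ^ d + ε ^ d * (d * 2 ^ (d - 1)) * (m : ℝ) ^ (d - 1) := by ring
      _ ≤ ε ^ d * (m : ℝ) ^ d + c * ε ^ (d - 1) * (m : ℝ) ^ (d - 1) := by gcongr
      _ = ε ^ d * (m : ℝ) ^ d + c * (ε ^ d * (m : ℝ) ^ d) ^ ((d - 1) / d) := by rw [h2]; ring
      _ ≤ f m + c * (f m : ℝ) ^ ((d - 1) / d) := by gcongr
      _ ≤ f (m + 1) := hf m

end Growth

section GKDim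

variable {k A : Type*} [Field k] [Ring A] [Algebra k A]

theorem finiteDimensional_pow (V : Submodule k A) [FiniteDimensional k V] (m : ℕ) :
    FiniteDimensional k ↥(V ^ m) :=
  Submodule.fg_iff_finiteDimensional _ |>.1
    (Submodule.FG.pow (Submodule.fg_iff_finiteDimensional _ |>.2 inferInstance) m)

theorem pow_ne_bot [Nontrivial A] {V : Submodule k A} (hV : (1 : A) ∈ V) (m : ℕ) : V ^ m ≠ ⊥ := by
  intro h
  have h1 : (1 : A) ∈ V ^ m := Submodule.one_le.1 (one_le_pow_of_one_le' (Submodule.one_le.2 hV) m)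
  rw [h, Submodule.mem_bot] at h1
  exact one_ne_zero h1

theorem finrank_pow_pos [Nontrivial A] {V : Submodule k A} (hV : IsSubframe k V) (m : ℕ) :
    0 < finrank k ↥(V ^ m) := by
  have := hV.1
  have := finiteDimensional_pow V m
  exact Nat.pos_of_ne_zero fun h => pow_ne_bot hV.2 m (Submodule.finrank_eq_zero.1 h)

theorem growthExponent_le_gkDim {V : Submodule k A} (hV : IsSubframe k V) :
    growthExponent (fun m => finrank k ↥(V ^ m)) ≤ gkDim k A :=
  le_iSup₂_of_le V hV le_rfl

/-- The algebra has to be nonzero: in the zero algebra every volume difference inequality holds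
vacuously. -/
theorem lowerTrDeg_le_gkDim [Nontrivial A] : lowerTrDeg k A ≤ gkDim k A := by
  refine iSup₂_le fun V hV => iSup₂_le fun d hd => iSup_le fun hVd => ?_
  obtain ⟨c, hc, h⟩ := hVd
  have := hV.1
  have hstep : ∀ m, (finrank k ↥(V ^ m) : ℝ) + c * (finrank k ↥(V ^ m) : ℝ) ^ ((d - 1) / d) ≤
      finrank k ↥(V ^ (m + 1)) := by
    intro m
    rw [pow_succ']
    exact h _ (finiteDimensional_pow V m) (pow_ne_bot hV.2 m)
  refine le_trans ?_ (growthExponent_le_gkDim hV)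
  -- For `d < 1` the inequality gives strict growth, which is the inequality for `d = 1`.
  rcases le_total 1 d with hd1 | hd1
  · obtain ⟨δ, hδ, hf⟩ := exists_mul_rpow_le_of_add_rpow_le hc hd1 (finrank_pow_pos hV 0) hstep
    exact le_growthExponent hδ hf
  · obtain ⟨δ, hδ, hf⟩ := exists_mul_rpow_le_of_add_rpow_le
      (f := fun m => finrank k ↥(V ^ m)) one_pos (le_refl (1 : ℝ)) (finrank_pow_pos hV 0)
      fun m => by
        have h1 : (0 : ℝ) < finrank k ↥(V ^ m) := by exact_mod_cast finrank_pow_pos hV m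
        have h2 : (finrank k ↥(V ^ m) : ℝ) < finrank k ↥(V ^ (m + 1)) :=
          lt_of_lt_of_le (lt_add_of_pos_right _ (by positivity)) (hstep m)
        have h3 : finrank k ↥(V ^ m) + 1 ≤ finrank k ↥(V ^ (m + 1)) := by exact_mod_cast h2
        simpa using (by exact_mod_cast h3 :
          (finrank k ↥(V ^ m) : ℝ) + 1 ≤ finrank k ↥(V ^ (m + 1)))
    exact (ENNReal.ofReal_le_ofReal hd1).trans (le_growthExponent hδ hf)

end GKDim

/-! ### Gelfand-Kirillov dimension of commutative algebras -/

section CommutativeGK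

variable {k D : Type*} [Field k] [CommRing D] [Algebra k D]

theorem exists_le_of_monotone {M : Type*} [AddCommGroup M] [Module k M] {S : ℕ → Submodule k M}
    (hS : Monotone S) (W : Submodule k M) [hW : FiniteDimensional k W]
    (h : ∀ x ∈ W, ∃ q, x ∈ S q) : ∃ q, W ≤ S q := by
  obtain ⟨s, rfl⟩ := (Submodule.fg_iff_finiteDimensional W).2 hW
  choose! q hq using h
  obtain ⟨M, hM⟩ := (s.image q).exists_le
  exact ⟨M, Submodule.span_le.2 fun x hx =>
    hS (hM _ (Finset.mem_image_of_mem q hx)) (hq x (Submodule.subset_span hx))⟩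

/-- The span of the products `y^e b_l`, where `y^e` is a monomial with exponents at most `q`. -/
def monomialSpan {t r : ℕ} (g : MvPolynomial (Fin t) k →ₐ[k] D) (b : Fin r → D) (q : ℕ) :
    Submodule k D :=
  Submodule.span k {x | ∃ (e : Fin t →₀ ℕ) (l : Fin r), (∀ i, e i ≤ q) ∧
    x = g (MvPolynomial.monomial e 1) * b l}

theorem monomialSpan_mono {t r : ℕ} (g : MvPolynomial (Fin t) k →ₐ[k] D) (b : Fin r → D) :
    Monotone (monomialSpan g b) := fun _ _ hq =>
  Submodule.span_mono fun _ ⟨e, l, he, hx⟩ => ⟨e, l, fun i => (he i).trans hq, hx⟩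

theorem finrank_monomialSpan_le {t r : ℕ} (g : MvPolynomial (Fin t) k →ₐ[k] D) (b : Fin r → D)
    (q : ℕ) : FiniteDimensional k (monomialSpan g b q) ∧
      finrank k (monomialSpan g b q) ≤ (q + 1) ^ t * r := by
  let v : (Fin t → Fin (q + 1)) × Fin r → D := fun x =>
    g (MvPolynomial.monomial (Finsupp.equivFunOnFinite.symm fun i => (x.1 i : ℕ)) 1) * b x.2
  have hv : monomialSpan g b q ≤ Submodule.span k (Set.range v) := by
    refine Submodule.span_mono ?_
    rintro x ⟨e, l, he, rfl⟩
    refine ⟨(fun i => ⟨e i, Nat.lt_succ_of_le (he i)⟩, l), ?_⟩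
    have h : (Finsupp.equivFunOnFinite.symm fun i => e i) = e := by ext; simp
    simp [v, h]
  have hfin : FiniteDimensional k (Submodule.span k (Set.range v)) :=
    FiniteDimensional.span_of_finite k (Set.finite_range v)
  refine ⟨Submodule.finiteDimensional_of_le hv, (Submodule.finrank_mono hv).trans ?_⟩
  refine (finrank_range_le_card (R := k) v).trans ?_
  simp

theorem mul_mem_monomialSpan {t r : ℕ} {g : MvPolynomial (Fin t) k →ₐ[k] D} {b : Fin r → D}
    {q m : ℕ} {e : Fin t →₀ ℕ} (he : ∀ i, e i ≤ m) {x : D} (hx : x ∈ monomialSpan g b q) :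
    g (MvPolynomial.monomial e 1) * x ∈ monomialSpan g b (m + q) := by
  induction hx using Submodule.span_induction with
  | mem x hx =>
    obtain ⟨e', l, he', rfl⟩ := hx
    refine Submodule.subset_span ⟨e + e', l, fun i => add_le_add (he i) (he' i), ?_⟩
    rw [← mul_assoc, ← map_mul, MvPolynomial.monomial_mul, one_mul]
  | zero => simp
  | add x y _ _ hx hy => rw [mul_add]; exact add_mem hx hy
  | smul r x _ hx => rw [mul_smul_comm]; exact Submodule.smul_mem _ _ hx

theorem exists_mem_monomialSpan {t r : ℕ} (g : MvPolynomial (Fin t) k →ₐ[k] D) (b : Fin r → D)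
    (c : Fin r → MvPolynomial (Fin t) k) : ∃ q, ∑ l, g (c l) * b l ∈ monomialSpan g b q := by
  have h : ∀ (p : MvPolynomial (Fin t) k) (l : Fin r), ∃ q, g p * b l ∈ monomialSpan g b q := by
    intro p l
    induction p using MvPolynomial.induction_on' with
    | monomial e a =>
      refine ⟨e.degree, ?_⟩
      have : MvPolynomial.monomial e a = a • MvPolynomial.monomial e (1 : k) := by
        rw [MvPolynomial.smul_monomial, smul_eq_mul, mul_one]
      rw [this, map_smul, smul_mul_assoc]
      exact Submodule.smul_mem _ _ (Submodule.subset_span ⟨e, l, fun i => e.le_degree i, rfl⟩)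
    | add p p' hp hp' =>
      obtain ⟨q, hq⟩ := hp
      obtain ⟨q', hq'⟩ := hp'
      refine ⟨max q q', ?_⟩
      rw [map_add, add_mul]
      exact add_mem (monomialSpan_mono g b (le_max_left _ _) hq)
        (monomialSpan_mono g b (le_max_right _ _) hq')
  choose q hq using fun l => h (c l) l
  obtain ⟨M, hM⟩ := (Finset.univ.image q).exists_le
  exact ⟨M, sum_mem fun l _ =>
    monomialSpan_mono g b (hM _ (Finset.mem_image_of_mem q (Finset.mem_univ l))) (hq l)⟩

/-- By Noether normalization the subalgebra generated by a subframe `V` is a finite module over a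
polynomial ring in some number `t` of variables, whence the powers of `V` grow at most like
`m ^ t`. -/
theorem exists_growthExponent_le [Nontrivial D] {V : Submodule k D} (hV : IsSubframe k V) :
    ∃ t : ℕ, (∃ g : MvPolynomial (Fin t) k →ₐ[k] D, Function.Injective g) ∧
      growthExponent (fun m => finrank k ↥(V ^ m)) ≤ t := by
  obtain ⟨hfin, h1⟩ := hV
  obtain ⟨s, hs⟩ := (Submodule.fg_iff_finiteDimensional V).2 hfin
  set B := Algebra.adjoin k (s : Set D) with hB
  have hVB : ∀ x ∈ V, x ∈ B := by
    rw [← hs]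
    exact fun x hx => Algebra.span_le_adjoin k _ hx
  have : Algebra.FiniteType k B :=
    (Subalgebra.fg_iff_finiteType B).1 (Subalgebra.fg_adjoin_finset s)
  obtain ⟨t, g₀, hg₀, hfin₀⟩ := exists_finite_inj_algHom_of_fg k B
  let g : MvPolynomial (Fin t) k →ₐ[k] D := B.val.comp g₀
  refine ⟨t, ⟨g, Subtype.val_injective.comp hg₀⟩, ?_⟩
  let : Algebra (MvPolynomial (Fin t) k) B := g₀.toRingHom.toAlgebra
  have hmod : Module.Finite (MvPolynomial (Fin t) k) B := hfin₀
  obtain ⟨r, b₀, hb₀⟩ := Module.Finite.exists_fin (R := MvPolynomial (Fin t) k) (M := B)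
  let b : Fin r → D := fun l => b₀ l
  have hmem : ∀ x ∈ B, ∃ q, x ∈ monomialSpan g b q := by
    intro x hx
    have hx' : (⟨x, hx⟩ : B) ∈ Submodule.span (MvPolynomial (Fin t) k) (Set.range b₀) := by
      rw [hb₀]
      trivial
    obtain ⟨c, hc⟩ := (Submodule.mem_span_range_iff_exists_fun _).1 hx'
    obtain ⟨q, hq⟩ := exists_mem_monomialSpan g b c
    refine ⟨q, ?_⟩
    have hc' : ∑ l, g (c l) * b l = x := by
      have := congrArg B.val hc
      rw [map_sum] at this
      exact this
    rwa [hc'] at hq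
  have hspan : FiniteDimensional k (Submodule.span k (Set.range b)) :=
    FiniteDimensional.span_of_finite k (Set.finite_range b)
  obtain ⟨q, hq⟩ := exists_le_of_monotone (monomialSpan_mono g b)
    (V * Submodule.span k (Set.range b)) (hW := (Submodule.fg_iff_finiteDimensional _).1
      (((Submodule.fg_iff_finiteDimensional _).2 hfin).mul
        ((Submodule.fg_iff_finiteDimensional _).2 hspan))) fun x hx => hmem x <| by
      have hle : V * Submodule.span k (Set.range b) ≤ Subalgebra.toSubmodule B := by
        refine Submodule.mul_le.2 fun v hv y hy => B.mul_mem (hVB v hv) ?_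
        have : Submodule.span k (Set.range b) ≤ Subalgebra.toSubmodule B :=
          Submodule.span_le.2 (Set.range_subset_iff.2 fun l => (b₀ l).2)
        exact this hy
      exact hle hx
  obtain ⟨q₀, hq₀⟩ := hmem 1 B.one_mem
  have hpow : ∀ m, V ^ m ≤ monomialSpan g b (m * q + q₀) := by
    intro m
    induction m with
    | zero => rw [pow_zero, zero_mul, zero_add]; exact Submodule.one_le.2 hq₀
    | succ m ih =>
      rw [pow_succ']
      refine Submodule.mul_le.2 fun v hv y hy => ?_
      replace hy := ih hy
      induction hy using Submodule.span_induction with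
      | mem y hy' =>
        obtain ⟨e, l, he, rfl⟩ := hy'
        rw [mul_left_comm]
        have := mul_mem_monomialSpan he
          (hq (Submodule.mul_mem_mul hv (Submodule.subset_span ⟨l, rfl⟩)))
        exact monomialSpan_mono g b (by ring_nf; omega) this
      | zero => simp
      | add x y _ _ hx hy => rw [mul_add]; exact add_mem hx hy
      | smul r x _ hx => rw [mul_smul_comm]; exact Submodule.smul_mem _ _ hx
  refine (growthExponent_le (G := fun _ => 1) (C := (q + q₀ + 1) ^ t * r) (t := t)
    (finrank_pow_pos ⟨hfin, h1⟩) fun m hm => ?_).trans (by rw [growthExponent_one, add_zero])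
  have := (finrank_monomialSpan_le g b (m * q + q₀)).1
  calc finrank k ↥(V ^ m)
    _ ≤ finrank k (monomialSpan g b (m * q + q₀)) := Submodule.finrank_mono (hpow m)
    _ ≤ (m * q + q₀ + 1) ^ t * r := (finrank_monomialSpan_le g b _).2
    _ ≤ ((q + q₀ + 1) * m) ^ t * r := by gcongr; nlinarith
    _ = (q + q₀ + 1) ^ t * r * m ^ t * 1 := by rw [mul_pow, mul_one, mul_right_comm]

end CommutativeGK

/-! ### Gelfand-Kirillov dimension of generalized Weyl algebras -/

section LatticeFiltration

variable {k D : Type*} [Field k] [CommRing D] [Algebra k D] {n : ℕ}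

/-- The functions supported in the box `[-m, m]ⁿ` with values in `V ^ m`. -/
def latticeFiltration (n : ℕ) (V : Submodule k D) (m : ℕ) : Submodule k ((Fin n → ℤ) →₀ D) where
  carrier := {p | ∀ α, p α ∈ V ^ m ∧ (p α ≠ 0 → ∀ i, |α i| ≤ m)}
  zero_mem' α := by simp
  add_mem' {p p'} hp hp' α := by
    refine ⟨add_mem (hp α).1 (hp' α).1, fun h => ?_⟩
    by_cases h0 : p α = 0
    · exact (hp' α).2 fun h0' => h (by rw [Finsupp.add_apply, h0, h0', add_zero])
    · exact (hp α).2 h0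
  smul_mem' c p hp α :=
    ⟨Submodule.smul_mem _ _ (hp α).1, fun h => (hp α).2 fun h0 => h (by simp [h0])⟩

theorem latticeFiltration_mono {V : Submodule k D} (hV : (1 : D) ∈ V) :
    Monotone (latticeFiltration n V) := fun _ _ h _ hp α =>
  ⟨pow_le_pow_right' (Submodule.one_le.2 hV) h (hp α).1,
    fun h0 i => ((hp α).2 h0 i).trans (by exact_mod_cast h)⟩

theorem finrank_latticeFiltration_le (V : Submodule k D) [FiniteDimensional k V] (m : ℕ) :
    FiniteDimensional k (latticeFiltration n V m) ∧
      finrank k (latticeFiltration n V m) ≤ (2 * m + 1) ^ n * finrank k ↥(V ^ m) := by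
  have := finiteDimensional_pow V m
  let φ : latticeFiltration n V m →ₗ[k] ((Fin n → Finset.Icc (-m : ℤ) m) → ↥(V ^ m)) :=
    { toFun := fun p β => ⟨p.1 fun i => β i, (p.2 _).1⟩
      map_add' := fun _ _ => rfl
      map_smul' := fun _ _ => rfl }
  have hφ : Function.Injective φ := by
    intro p p' h
    ext α
    by_cases hα : ∀ i, |α i| ≤ m
    · have := congrFun h fun i => ⟨α i, Finset.mem_Icc.2 (abs_le.1 (hα i))⟩
      exact congrArg Subtype.val this
    · rw [not_ne_iff.1 fun h0 => hα ((p.2 α).2 h0), not_ne_iff.1 fun h0 => hα ((p'.2 α).2 h0)]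
  refine ⟨Module.Finite.of_injective φ hφ, (LinearMap.finrank_le_finrank_of_injective hφ).trans ?_⟩
  rw [Module.finrank_pi_fintype]
  simp only [Finset.sum_const, Finset.card_univ, Fintype.card_fun, Fintype.card_coe, Int.card_Icc,
    Fintype.card_fin, smul_eq_mul]
  rw [show ((m : ℤ) + 1 - -m).toNat = 2 * m + 1 by omega]

end LatticeFiltration

namespace GWAData

section GK

variable {k D : Type*} [Field k] [CommRing D] [Algebra k D] {n : ℕ} (w : GWAData k D n)

/-- Elements of `U` raise the degree in the filtration attached to `V` by a bounded amount, for all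
large enough `σ`-stable `V` containing `1`. -/
def BoundedDegree (U : Submodule k (GWA w)) : Prop :=
  ∃ V₀ : Submodule k D, FiniteDimensional k V₀ ∧ ∀ V : Submodule k D, V₀ ≤ V → (1 : D) ∈ V →
    (∀ i, V.map (w.σ i).toLinearMap = V) → ∃ s : ℕ, ∀ r ∈ U, ∀ m,
      ∀ p ∈ latticeFiltration n V m, w.rep r p ∈ latticeFiltration n V (m + s)

variable {w}

theorem map_symm_eq {V : Submodule k D} {i : Fin n} (h : V.map (w.σ i).toLinearMap = V) :
    V.map (w.σ i).symm.toLinearMap = V := by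
  have h1 : (w.σ i).symm.toLinearMap ∘ₗ (w.σ i).toLinearMap = LinearMap.id := by
    ext
    simp
  conv_lhs => rw [← h]
  rw [← Submodule.map_comp, h1, Submodule.map_id]

theorem apply_mem_pow {V : Submodule k D} {τ : D ≃ₐ[k] D} (h : V.map τ.toLinearMap = V) {m : ℕ}
    {d : D} (hd : d ∈ V ^ m) : τ d ∈ V ^ m := by
  have h1 : (V ^ m).map τ.toLinearMap = V ^ m := by
    have := Submodule.map_pow V (τ : D →ₐ[k] D) m
    rw [show (τ : D →ₐ[k] D).toLinearMap = τ.toLinearMap from rfl, h] at this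
    exact this
  rw [← h1]
  exact ⟨d, hd, rfl⟩

theorem shiftOp_mem_latticeFiltration {V : Submodule k D} {τ : D ≃ₐ[k] D}
    (h : V.map τ.toLinearMap = V) {c : ℤ → D} (hc : ∀ p, c p ∈ V) (i : Fin n) {δ : ℤ}
    (hδ : |δ| ≤ 1) {m : ℕ} {p : (Fin n → ℤ) →₀ D} (hp : p ∈ latticeFiltration n V m) :
    shiftOp (fun q => LinearMap.mulLeft k (c q) ∘ₗ τ.toLinearMap) i δ p ∈
      latticeFiltration n V (m + 1) := by
  intro α
  rw [shiftOp_apply]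
  refine ⟨?_, fun h0 j => ?_⟩
  · rw [pow_succ']
    exact Submodule.mul_mem_mul (hc _) (apply_mem_pow h (hp _).1)
  · have h1 : p (α - Pi.single i δ) ≠ 0 := fun h1 => h0 (by rw [h1, map_zero])
    have h2 := (hp _).2 h1 j
    rw [Pi.sub_apply, Pi.single_apply] at h2
    push_cast
    rw [abs_le] at *
    split_ifs at h2 <;> constructor <;> omega

theorem boundedDegree_span_singleton (r : GWA w) : BoundedDegree w (Submodule.span k {r}) := by
  have key : ∃ V₀ : Submodule k D, FiniteDimensional k V₀ ∧ ∀ V : Submodule k D, V₀ ≤ V →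
      (1 : D) ∈ V → (∀ i, V.map (w.σ i).toLinearMap = V) → ∃ s : ℕ, ∀ m,
      ∀ p ∈ latticeFiltration n V m, w.rep r p ∈ latticeFiltration n V (m + s) := by
    induction r using w.induction_on with
    | coeff d =>
      refine ⟨Submodule.span k {d}, inferInstance, fun V hV _ _ => ⟨1, fun m p hp α => ?_⟩⟩
      have hd : d ∈ V := hV (Submodule.mem_span_singleton_self d)
      rw [rep_coeff]
      refine ⟨?_, fun h0 i => ?_⟩
      · rw [pow_succ']
        exact Submodule.mul_mem_mul hd (hp α).1
      · have h1 : p α ≠ 0 := fun h1 => h0 (by simp [genAct, h1])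
        exact ((hp α).2 h1 i).trans (by push_cast; omega)
    | pos i =>
      refine ⟨Submodule.span k {w.σ i (w.a i)}, inferInstance,
        fun V hV h1 hσ => ⟨1, fun m p hp => ?_⟩⟩
      rw [rep_xPos]
      refine shiftOp_mem_latticeFiltration (hσ i) (fun q => ?_) i (by norm_num) hp
      unfold posCoeff
      split_ifs
      · exact h1
      · exact hV (Submodule.mem_span_singleton_self _)
    | neg i =>
      refine ⟨Submodule.span k {w.a i}, inferInstance,
        fun V hV h1 hσ => ⟨1, fun m p hp => ?_⟩⟩
      rw [rep_xNeg]
      refine shiftOp_mem_latticeFiltration (map_symm_eq (hσ i)) (fun q => ?_) i (by norm_num) hp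
      unfold negCoeff
      split_ifs
      · exact h1
      · exact hV (Submodule.mem_span_singleton_self _)
    | add r r' hr hr' =>
      obtain ⟨V₁, _, h₁⟩ := hr
      obtain ⟨V₂, _, h₂⟩ := hr'
      refine ⟨V₁ ⊔ V₂, inferInstance, fun V hV h1 hσ => ?_⟩
      obtain ⟨s₁, hs₁⟩ := h₁ V (le_sup_left.trans hV) h1 hσ
      obtain ⟨s₂, hs₂⟩ := h₂ V (le_sup_right.trans hV) h1 hσ
      refine ⟨s₁ + s₂, fun m p hp => ?_⟩
      rw [map_add]
      exact add_mem (latticeFiltration_mono h1 (by omega) (hs₁ m p hp))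
        (latticeFiltration_mono h1 (by omega) (hs₂ m p hp))
    | mul r r' hr hr' =>
      obtain ⟨V₁, _, h₁⟩ := hr
      obtain ⟨V₂, _, h₂⟩ := hr'
      refine ⟨V₁ ⊔ V₂, inferInstance, fun V hV h1 hσ => ?_⟩
      obtain ⟨s₁, hs₁⟩ := h₁ V (le_sup_left.trans hV) h1 hσ
      obtain ⟨s₂, hs₂⟩ := h₂ V (le_sup_right.trans hV) h1 hσ
      refine ⟨s₂ + s₁, fun m p hp => ?_⟩
      rw [map_mul, ← add_assoc]
      exact hs₁ _ _ (hs₂ m p hp)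
  obtain ⟨V₀, hV₀, h⟩ := key
  refine ⟨V₀, hV₀, fun V hV h1 hσ => ?_⟩
  obtain ⟨s, hs⟩ := h V hV h1 hσ
  refine ⟨s, fun r' hr' m p hp => ?_⟩
  obtain ⟨c, rfl⟩ := Submodule.mem_span_singleton.1 hr'
  rw [map_smul]
  exact Submodule.smul_mem _ c (hs m p hp)

theorem boundedDegree (U : Submodule k (GWA w)) (hU : U.FG) : BoundedDegree w U := by
  induction U, hU using Submodule.fg_induction with
  | singleton r => exact boundedDegree_span_singleton r
  | sup U₁ U₂ _ _ h₁ h₂ =>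
    obtain ⟨V₁, _, h₁⟩ := h₁
    obtain ⟨V₂, _, h₂⟩ := h₂
    refine ⟨V₁ ⊔ V₂, inferInstance, fun V hV h1 hσ => ?_⟩
    obtain ⟨s₁, hs₁⟩ := h₁ V (le_sup_left.trans hV) h1 hσ
    obtain ⟨s₂, hs₂⟩ := h₂ V (le_sup_right.trans hV) h1 hσ
    refine ⟨s₁ + s₂, fun r hr m p hp => ?_⟩
    obtain ⟨r₁, hr₁, r₂, hr₂, rfl⟩ := Submodule.mem_sup.1 hr
    rw [map_add]
    exact add_mem (latticeFiltration_mono h1 (by omega) (hs₁ r₁ hr₁ m p hp))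
      (latticeFiltration_mono h1 (by omega) (hs₂ r₂ hr₂ m p hp))

variable (w)

theorem gkDim_le [Nontrivial D] (hσ : ∀ U : Submodule k D, FiniteDimensional k U →
      ∃ V : Submodule k D, FiniteDimensional k V ∧ U ≤ V ∧
        ∀ i : Fin n, V.map (w.σ i).toLinearMap = V) :
    gkDim k (GWA w) ≤ gkDim k D + n := by
  have := w.nontrivial_gwa
  refine iSup₂_le fun U hU => ?_
  have hUfin := hU.1
  obtain ⟨V₀, _, hV₀⟩ := boundedDegree U ((Submodule.fg_iff_finiteDimensional U).2 hU.1)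
  obtain ⟨V, hVfin, hV, hVσ⟩ := hσ (V₀ ⊔ Submodule.span k {1}) inferInstance
  have h1 : (1 : D) ∈ V := hV (le_sup_right (a := V₀) (Submodule.mem_span_singleton_self 1))
  obtain ⟨s, hs⟩ := hV₀ V (le_sup_left.trans hV) h1 hVσ
  have hpow : ∀ m, (U ^ m).map w.toLattice ≤ latticeFiltration n V (m * s) := by
    intro m
    rw [Submodule.map_le_iff_le_comap]
    induction m with
    | zero =>
      rw [pow_zero, zero_mul]
      refine Submodule.one_le.2 fun α => ?_
      rw [toLattice_one, pow_zero]
      by_cases hα : α = 0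
      · subst hα
        simp
      · simp [Finsupp.single_eq_of_ne hα]
    | succ m ih =>
      rw [pow_succ']
      refine Submodule.mul_le.2 fun r hr x hx => ?_
      rw [Submodule.mem_comap, toLattice_mul, Nat.succ_mul]
      exact hs r hr _ _ (ih hx)
  have hVs : IsSubframe k (V ^ s) :=
    ⟨finiteDimensional_pow V s, Submodule.one_le.1 (one_le_pow_of_one_le' (Submodule.one_le.2 h1) s)⟩
  refine (growthExponent_le (F := fun m => finrank k ↥(U ^ m))
    (G := fun m => finrank k ↥((V ^ s) ^ m)) (C := (2 * s + 1) ^ n) (t := n) (finrank_pow_pos hU)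
    fun m hm => ?_).trans ?_
  · have := (finrank_latticeFiltration_le (n := n) V (m * s)).1
    calc finrank k ↥(U ^ m)
      _ = finrank k ↥((U ^ m).map w.toLattice) :=
          (Submodule.equivMapOfInjective _ w.toLattice_injective _).finrank_eq
      _ ≤ finrank k (latticeFiltration n V (m * s)) := Submodule.finrank_mono (hpow m)
      _ ≤ (2 * (m * s) + 1) ^ n * finrank k ↥(V ^ (m * s)) := (finrank_latticeFiltration_le V _).2
      _ ≤ ((2 * s + 1) * m) ^ n * finrank k ↥(V ^ (m * s)) := by gcongr; nlinarith
      _ = (2 * s + 1) ^ n * m ^ n * finrank k ↥((V ^ s) ^ m) := by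
          rw [mul_pow, mul_comm m s, pow_mul]
  · rw [add_comm]
    exact add_le_add (growthExponent_le_gkDim hVs) le_rfl

end GK

/-! ### Lower transcendence degree of generalized Weyl algebras -/

section LD

variable {k D : Type*} [Field k] [CommRing D] [IsDomain D] [Algebra k D] {n : ℕ}
  (w : GWAData k D n)

theorem posAct_injective (i : Fin n) (p : ℤ) : Function.Injective (w.posAct i p) := by
  have hc : w.posCoeff i p ≠ 0 := by
    unfold posCoeff
    split_ifs
    · exact one_ne_zero
    · exact fun h => nonZeroDivisors.ne_zero (w.a_mem_nonZeroDivisors i) (by simpa using h)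
  exact (mul_right_injective₀ hc).comp (w.σ i).injective

/-- The volume difference inequality is satisfied by the span of `1`, of the `t` variables and of the
elements `X_i⁺`. -/
theorem le_lowerTrDeg {t : ℕ} (g : MvPolynomial (Fin t) k →ₐ[k] D) (hg : Function.Injective g) :
    (t : ℝ≥0∞) + n ≤ lowerTrDeg k (GWA w) := by
  set y : Fin t → GWA w := fun j => w.coeffHom (g (MvPolynomial.X j)) with hy
  have hexp : Expands k (Set.range (fun j => LinearMap.mulLeft k (y j)) ∪
      Set.range fun i => LinearMap.mulLeft k (w.xPos i)) (t + n) := by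
    refine ((expands_mulLeft g hg).finsupp w.posAct w.posAct_injective).of_injective w.toLattice
      w.toLattice_injective ?_
    rintro f (⟨_, ⟨j, rfl⟩, rfl⟩ | ⟨i, rfl⟩)
    · refine ⟨_, Or.inl ⟨j, rfl⟩, fun r => ?_⟩
      rw [LinearMap.mulLeft_apply, toLattice_mul, hy, rep_coeff]
      rfl
    · refine ⟨_, Or.inr ⟨i, rfl⟩, fun r => ?_⟩
      rw [LinearMap.mulLeft_apply, toLattice_mul, rep_xPos]
      rfl
  rcases hexp with h0 | ⟨c, hc, h⟩
  · have : (t : ℝ≥0∞) + n = 0 := by exact_mod_cast h0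
    rw [this]
    exact zero_le
  by_cases h0 : t + n = 0
  · have : (t : ℝ≥0∞) + n = 0 := by exact_mod_cast h0
    rw [this]
    exact zero_le
  set V : Submodule k (GWA w) :=
    Submodule.span k (insert 1 (Set.range y ∪ Set.range w.xPos)) with hV
  have hVfin : FiniteDimensional k V := FiniteDimensional.span_of_finite k
    (((Set.finite_range y).union (Set.finite_range w.xPos)).insert 1)
  have h1 : (1 : GWA w) ∈ V := Submodule.subset_span (Set.mem_insert _ _)
  have hpos : (0 : ℝ) < (t + n : ℕ) := by exact_mod_cast Nat.pos_of_ne_zero h0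
  refine le_iSup₂_of_le V ⟨hVfin, h1⟩ (le_iSup₂_of_le ((t + n : ℕ) : ℝ) hpos
    (le_iSup_of_le ⟨c, hc, fun W hW hW0 => ?_⟩ ?_))
  · refine h W (V * W) ?_ hW0 ?_ ?_
    · exact (Submodule.fg_iff_finiteDimensional _).1
        (((Submodule.fg_iff_finiteDimensional _).2 hVfin).mul
          ((Submodule.fg_iff_finiteDimensional _).2 hW))
    · intro x hx
      rw [← one_mul x]
      exact Submodule.mul_mem_mul h1 hx
    · rintro f (⟨j, rfl⟩ | ⟨i, rfl⟩) _ ⟨x, hx, rfl⟩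
      · exact Submodule.mul_mem_mul (Submodule.subset_span (Or.inr (Or.inl ⟨j, rfl⟩))) hx
      · exact Submodule.mul_mem_mul (Submodule.subset_span (Or.inr (Or.inr ⟨i, rfl⟩))) hx
  · rw [ENNReal.ofReal_natCast]
    push_cast
    exact le_rfl

theorem gkDim_add_le_lowerTrDeg : gkDim k D + n ≤ lowerTrDeg k (GWA w) := by
  have key : ∀ V : Submodule k D, IsSubframe k V →
      growthExponent (fun m => finrank k ↥(V ^ m)) + n ≤ lowerTrDeg k (GWA w) := by
    intro V hV
    obtain ⟨t, ⟨g, hg⟩, ht⟩ := exists_growthExponent_le hV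
    exact (add_le_add ht le_rfl).trans (w.le_lowerTrDeg g hg)
  have hn : (n : ℝ≥0∞) ≤ lowerTrDeg k (GWA w) :=
    le_add_self.trans (key (Submodule.span k {1})
      ⟨inferInstance, Submodule.mem_span_singleton_self 1⟩)
  have h : gkDim k D ≤ lowerTrDeg k (GWA w) - n := iSup₂_le fun V hV =>
    ENNReal.le_sub_of_add_le_right (ENNReal.natCast_ne_top n) (key V hV)
  exact (add_le_add h le_rfl).trans (tsub_add_cancel_of_le hn).le

end LD

end GWAData

end

theorem proposition5p6 {k D : Type*} [Field k] [CharZero k] [CommRing D] [IsDomain D]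
    [IsNoetherianRing D] [Algebra k D] {n : ℕ} (w : GWAData k D n)
    (hσ : ∀ U : Submodule k D, FiniteDimensional k U →
      ∃ V : Submodule k D, FiniteDimensional k V ∧ U ≤ V ∧
        ∀ i : Fin n, V.map (w.σ i).toLinearMap = V) :
    IsLDStable k (GWA w) ∧ lowerTrDeg k (GWA w) = gkDim k D + (n : ℝ≥0∞) := by
  have := w.nontrivial_gwa
  have h1 := w.gkDim_add_le_lowerTrDeg
  have h2 := w.gkDim_le hσ
  have h3 : lowerTrDeg k (GWA w) ≤ gkDim k (GWA w) := lowerTrDeg_le_gkDim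
  exact ⟨h3.antisymm (h2.trans h1), (h3.trans h2).antisymm h1⟩
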